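/- **Conventions.** Let $G$ be a discrete group, $N$ a normal subgroup of $G$ and $q:G\to G/N$ the quotient map. All algebras are complex and ⊗ between $C^*$-algebras is the minimal (spatial) tensor product; $C^*(G)$ is the full group $C^*$-algebra, and $s\in G$ also denotes its image in $C^*(G)$. A *Fell bundle* $\mathcal A$ over $G$ consists of complex Banach spaces $A_s$ ($s\in G$), associative bilinear multiplications $A_s\times A_t\to A_{st}$ and conjugate-linear, anti-multiplicative, involutive maps ${}^*:A_s\to A_{s^{-1}}$, such that $\|ab\|\le\|a\|\|b\|$, $\|a^*\|=\|a\|$, $\|a^*a\|=\|a\|^2$, and $a^*a$ is a positive element of the $C^*$-algebra $A_e$, for all $a,b\in\mathcal A=\bigsqcup_s A_s$. An isomorphism of Fell bundles over $G$ is a family of isometric linear bijections of the fibers over each $s\in G$ that respects multiplication and involution. If $\mathcal D$ is a Fell bundle over $G/N$, the *pull-back* $q^*\mathcal D$ is the Fell bundle over $G$ whose fiber over $s$ is $D_{sN}\times\{s\}$, with $(d,s)(e,t)=(de,st)$ and $(d,s)^*=(d^*,s^{-1})$. A *multiplier of order* $s$ of $\mathcal A$ is a pair $m=(L,R)$ of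 maps $\mathcal A\to\mathcal A$ with $L(A_t)\subset A_{st}$ and $R(A_t)\subset A_{ts}$ for all $t\in G$, and $R(a)b=aL(b)$ for all $a,b\in\mathcal A$; one writes $ma=L(a)$, $am=R(a)$, and $M(A_s)$ for the set of multipliers of order $s$. Multipliers are multiplied by $(mm')a=m(m'a)$, $a(mm')=(am)m'$, and the adjoint is given by $m^*a=(a^*m)^*$, $am^*=(ma^*)^*$. Let $UM(\mathcal A)$ be the group of unitary multipliers ($m^*m=mm^*=1$) of $\mathcal A$, of any order. For a $C^*$-algebra $A$, $UM(A)$ is the unitary group of the multiplier algebra $M(A)$. A *coaction* $(A,G,\delta)$ is an injective $*$-homomorphism $\delta:A\to A\otimes C^*(G)$ of a $C^*$-algebra $A$ that is nondegenerate (the closed linear span of $\delta(A)(A\otimes C^*(G))$ is $A\otimes C^*(G)$) and satisfies $(\delta\otimes\mathrm{id})\circ\delta=(\mathrm{id}\otimes\delta_G)\circ\delta$, where $\delta_G:C^*(G)\to C^*(G)\otimes C^*(G)$ is given by $\delta_G(s)=s\otimes s$; $\delta$ also denotes its extension $M(A)\to M(A\otimes C^*(G))$. The *associated Fell bundle* has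 as fibers the spectral subspaces $A_s=\{a\in A:\delta(a)=a\otimes s\}$, with the operations of $A$. The coaction is *weakly induced* from $G/N$ if its associated Fell bundle is isomorphic to $q^*\mathcal D$ for some Fell bundle $\mathcal D$ over $G/N$. **Theorem 5.1.** A Fell bundle $\mathcal A$ over $G$ is isomorphic to a pull-back bundle $q^*\mathcal D$ for some Fell bundle $\mathcal D$ over $G/N$ if and only if there is a homomorphism $u:N\to UM(\mathcal A)$ such that (i) $u_n\in M(A_n)$ for all $n\in N$; (ii) $a_su_n=u_{sns^{-1}}a_s$ for all $s\in G$, $a_s\in A_s$, $n\in N$. Consequently, a coaction $(A,G,\delta)$ is weakly induced from $G/N$ if and only if there is a homomorphism $u:N\to UM(A)$ such that $\delta(u_n)=u_n\otimes n$ for all $n\in N$ and (ii) holds for the spectral subspaces $A_s$ of $\delta$. -/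

import Mathlib

universe u v

open scoped TensorProduct MultiplierAlgebra

noncomputable section

/-! ## Fell bundles over discrete groups -/

/-- A Fell bundle over the discrete group `G`: complex Banach spaces `fiber s` for `s : G`, bilinear
multiplications `fiber s × fiber t → fiber (s * t)` and conjugate-linear involutions
`fiber s → fiber s⁻¹`. Identities between elements of fibers that are only propositionally equal
are stated in the total space `Σ s, fiber s`. -/
structure FellBundle (G : Type u) [Group G] where
  fiber : G → Type v
  [normedAddCommGroup : ∀ s, NormedAddCommGroup (fiber s)]
  [normedSpace : ∀ s, NormedSpace ℂ (fiber s)]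
  [completeSpace : ∀ s, CompleteSpace (fiber s)]
  mul : ∀ {s t : G}, fiber s →ₗ[ℂ] fiber t →ₗ[ℂ] fiber (s * t)
  star : ∀ {s : G}, fiber s →ₗ⋆[ℂ] fiber s⁻¹
  norm_mul_le : ∀ {s t : G} (a : fiber s) (b : fiber t), ‖mul a b‖ ≤ ‖a‖ * ‖b‖
  norm_star : ∀ {s : G} (a : fiber s), ‖star a‖ = ‖a‖
  mul_assoc : ∀ {r s t : G} (a : fiber r) (b : fiber s) (c : fiber t),
    (⟨_, mul (mul a b) c⟩ : Σ s, fiber s) = ⟨_, mul a (mul b c)⟩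
  star_mul : ∀ {s t : G} (a : fiber s) (b : fiber t),
    (⟨_, star (mul a b)⟩ : Σ s, fiber s) = ⟨_, mul (star b) (star a)⟩
  star_star : ∀ {s : G} (a : fiber s), (⟨_, star (star a)⟩ : Σ s, fiber s) = ⟨_, a⟩
  norm_star_mul_self : ∀ {s : G} (a : fiber s), ‖mul (star a) a‖ = ‖a‖ ^ 2
  /-- `a* a` is a positive element of the `C*`-algebra `fiber 1`. -/
  star_mul_self_nonneg : ∀ {s : G} (a : fiber s), ∃ b : fiber 1,
    (⟨_, mul (star a) a⟩ : Σ s, fiber s) = ⟨_, mul (star b) b⟩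

namespace FellBundle

attribute [instance] FellBundle.normedAddCommGroup FellBundle.normedSpace
  FellBundle.completeSpace

variable {G : Type u} [Group G]

/-- The total space of a Fell bundle. -/
def Total (𝒜 : FellBundle.{u, v} G) : Type (max u v) := Σ s, 𝒜.fiber s

instance (𝒜 : FellBundle.{u, v} G) : Semigroup 𝒜.Total where
  mul a b := ⟨a.1 * b.1, 𝒜.mul a.2 b.2⟩
  mul_assoc a b c := 𝒜.mul_assoc a.2 b.2 c.2

instance (𝒜 : FellBundle.{u, v} G) : StarMul 𝒜.Total where
  star a := ⟨a.1⁻¹, 𝒜.star a.2⟩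
  star_involutive a := 𝒜.star_star a.2
  star_mul a b := 𝒜.star_mul a.2 b.2

/-- An isomorphism of Fell bundles over `G`: isometric linear bijections between the fibers over
each `s : G` that preserve multiplication and involution. -/
structure Iso (𝒜 ℬ : FellBundle.{u, v} G) where
  toEquiv : ∀ s, 𝒜.fiber s ≃ₗᵢ[ℂ] ℬ.fiber s
  map_mul : ∀ {s t : G} (a : 𝒜.fiber s) (b : 𝒜.fiber t),
    toEquiv (s * t) (𝒜.mul a b) = ℬ.mul (toEquiv s a) (toEquiv t b)
  map_star : ∀ {s : G} (a : 𝒜.fiber s), toEquiv s⁻¹ (𝒜.star a) = ℬ.star (toEquiv s a)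

/-- The pull-back `q^*𝒟` of a Fell bundle over `G ⧸ N` along the quotient map `q : G → G ⧸ N`: the
fiber over `s` is the fiber of `𝒟` over `sN`, with the operations of `𝒟`. -/
def pullback (N : Subgroup G) [N.Normal] (𝒟 : FellBundle.{u, v} (G ⧸ N)) :
    FellBundle.{u, v} G where
  fiber s := 𝒟.fiber (s : G ⧸ N)
  mul {s t} := 𝒟.mul (s := (s : G ⧸ N)) (t := (t : G ⧸ N))
  star {s} := 𝒟.star (s := (s : G ⧸ N))
  norm_mul_le a b := 𝒟.norm_mul_le a b
  norm_star a := 𝒟.norm_star a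
  mul_assoc a b c := Sigma.ext (_root_.mul_assoc _ _ _) (Sigma.ext_iff.1 (𝒟.mul_assoc a b c)).2
  star_mul a b := Sigma.ext (mul_inv_rev _ _) (Sigma.ext_iff.1 (𝒟.star_mul a b)).2
  star_star a := Sigma.ext (inv_inv _) (Sigma.ext_iff.1 (𝒟.star_star a)).2
  norm_star_mul_self a := 𝒟.norm_star_mul_self a
  star_mul_self_nonneg {s} a := by
    obtain ⟨b, hb⟩ := 𝒟.star_mul_self_nonneg a
    exact ⟨b, Sigma.ext (by simp) (Sigma.ext_iff.1 hb).2⟩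

/-- A multiplier of a Fell bundle `𝒜`: a pair `m = (L, R)` of maps of the total space to itself,
`L a = m a` and `R a = a m`, such that for some `s : G` (the order of `m`) `L` maps the fiber over
`t` to the fiber over `s * t` and `R` maps it to the fiber over `t * s`, and such that
`(a m) b = a (m b)`. -/
@[ext]
structure Multiplier (𝒜 : FellBundle.{u, v} G) where
  left : 𝒜.Total → 𝒜.Total
  right : 𝒜.Total → 𝒜.Total
  exists_order : ∃ s : G, (∀ a, (left a).1 = s * a.1) ∧ ∀ a, (right a).1 = a.1 * s
  assoc : ∀ a b, right a * b = a * left b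

/-- The set `M(A_s)` of multipliers of order `s`. -/
def multipliersOfOrder (𝒜 : FellBundle.{u, v} G) (s : G) : Set 𝒜.Multiplier :=
  {m | (∀ a, (m.left a).1 = s * a.1) ∧ ∀ a, (m.right a).1 = a.1 * s}

/-- The product of multipliers: `(m m') a = m (m' a)` and `a (m m') = (a m) m'`. -/
instance (𝒜 : FellBundle.{u, v} G) : Monoid 𝒜.Multiplier where
  mul m m' :=
    { left := m.left ∘ m'.left
      right := m'.right ∘ m.right
      exists_order := by
        obtain ⟨s, hs, hs'⟩ := m.exists_order
        obtain ⟨t, ht, ht'⟩ := m'.exists_order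
        exact ⟨s * t, fun a => by simp [hs, ht, _root_.mul_assoc],
          fun a => by simp [hs', ht', _root_.mul_assoc]⟩
      assoc := fun a b => by simp [m.assoc, m'.assoc] }
  one := ⟨id, id, ⟨1, by simp, by simp⟩, fun _ _ => rfl⟩
  mul_assoc _ _ _ := rfl
  one_mul _ := rfl
  mul_one _ := rfl

/-- The adjoint of a multiplier: `m* a = (a* m)*` and `a m* = (m a*)*`. -/
instance (𝒜 : FellBundle.{u, v} G) : StarMul 𝒜.Multiplier where
  star m :=
    { left := fun a => Star.star (m.right (Star.star a))
      right := fun a => Star.star (m.left (Star.star a))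
      exists_order := by
        obtain ⟨s, hs, hs'⟩ := m.exists_order
        refine ⟨s⁻¹, fun a => ?_, fun a => ?_⟩
        · change (m.right (Star.star a)).1⁻¹ = _
          rw [hs']; change (a.1⁻¹ * s)⁻¹ = _; group
        · change (m.left (Star.star a)).1⁻¹ = _
          rw [hs]; change (s * a.1⁻¹)⁻¹ = _; group
      assoc := fun a b => by
        have h := congrArg Star.star (m.assoc (Star.star b) (Star.star a))
        simpa using h.symm }
  star_involutive m := by
    ext1 <;> funext a <;> simp
  star_mul m m' := by
    ext1 <;> funext a
    · change _ = Star.star (m'.right (Star.star (Star.star (m.right (Star.star a)))))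
      rw [_root_.star_star]; rfl
    · change _ = Star.star (m.left (Star.star (Star.star (m'.left (Star.star a)))))
      rw [_root_.star_star]; rfl

end FellBundle

/-! ## Completions of `*`-algebras with respect to `C*`-seminorms -/

/-- A `C*`-seminorm on a complex `*`-algebra. -/
structure CStarSeminorm (R : Type u) [NonUnitalRing R] [StarRing R] [Module ℂ R] extends
    Seminorm ℂ R where
  mul_le' : ∀ x y : R, toFun (x * y) ≤ toFun x * toFun y
  star_mul_self' : ∀ x : R, toFun (star x * x) = toFun x ^ 2

namespace CStarSeminorm

section
variable {R : Type u} [NonUnitalRing R] [StarRing R] [Module ℂ R]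

instance : CoeFun (CStarSeminorm R) (fun _ => R → ℝ) := ⟨fun p => p.toSeminorm⟩

theorem mul_le (p : CStarSeminorm R) (x y : R) : p (x * y) ≤ p x * p y := p.mul_le' x y

theorem star_mul_self (p : CStarSeminorm R) (x : R) : p (star x * x) = p x ^ 2 :=
  p.star_mul_self' x

theorem star_eq (p : CStarSeminorm R) (x : R) : p (star x) = p x := by
  have key : ∀ y : R, p y ≤ p (star y) := by
    intro y
    rcases (apply_nonneg p.toSeminorm y).eq_or_lt' with h | h
    · rw [h]; exact apply_nonneg _ _
    · have := (p.star_mul_self y).symm.trans_le (p.mul_le _ _)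
      rw [sq] at this
      exact le_of_mul_le_mul_right this h
  exact le_antisymm (by simpa using key (star x)) (key x)

theorem mul_star_self (p : CStarSeminorm R) (x : R) : p (x * star x) = p x ^ 2 := by
  simpa [p.star_eq] using p.star_mul_self (star x)

/-- The `C*`-seminorm `x ↦ ‖f x‖` of a `*`-homomorphism `f` to a `C*`-algebra. -/
def ofHom {B : Type v} [NonUnitalCStarAlgebra B] (f : R →⋆ₙₐ[ℂ] B) : CStarSeminorm R where
  toFun x := ‖f x‖
  map_zero' := by simp
  add_le' x y := by rw [map_add]; exact norm_add_le _ _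
  neg' x := by rw [map_neg, norm_neg]
  smul' c x := by rw [map_smul, norm_smul]
  mul_le' x y := by rw [map_mul]; exact norm_mul_le _ _
  star_mul_self' x := by rw [map_mul, map_star, CStarRing.norm_star_mul_self, sq]

theorem ofHom_apply {B : Type v} [NonUnitalCStarAlgebra B] (f : R →⋆ₙₐ[ℂ] B) (x : R) :
    ofHom f x = ‖f x‖ := rfl

open scoped Pointwise in
/-- The supremum of a non-empty pointwise bounded family of `C*`-seminorms. -/
def sup (S : Set (CStarSeminorm R)) (hne : S.Nonempty)
    (hb : ∀ x, BddAbove ((fun p : CStarSeminorm R => p x) '' S)) : CStarSeminorm R :=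
  have le : ∀ x, ∀ p ∈ S, p x ≤ sSup ((fun p : CStarSeminorm R => p x) '' S) :=
    fun x p hp => le_csSup (hb x) ⟨p, hp, rfl⟩
  have ub : ∀ x c, (∀ p ∈ S, p x ≤ c) → sSup ((fun p : CStarSeminorm R => p x) '' S) ≤ c :=
    fun x c h => csSup_le (hne.image _) (by rintro _ ⟨p, hp, rfl⟩; exact h p hp)
  have nn : ∀ x, 0 ≤ sSup ((fun p : CStarSeminorm R => p x) '' S) := fun x =>
    (apply_nonneg hne.some.toSeminorm x).trans (le x _ hne.some_mem)
  { toFun := fun x => sSup ((fun p : CStarSeminorm R => p x) '' S)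
    map_zero' := le_antisymm (ub _ _ fun p _ => (map_zero p.toSeminorm).le) (nn 0)
    add_le' := fun x y => ub _ _ fun p hp =>
      (map_add_le_add p.toSeminorm x y).trans (add_le_add (le x p hp) (le y p hp))
    neg' := fun x => by
      congr 1
      exact Set.image_congr fun p _ => map_neg_eq_map p.toSeminorm x
    smul' := fun c x => by
      have h : (fun p : CStarSeminorm R => p (c • x)) '' S =
          ‖c‖ • ((fun p : CStarSeminorm R => p x) '' S) := by
        rw [← Set.image_smul, Set.image_image]
        exact Set.image_congr fun p _ => map_smul_eq_mul p.toSeminorm c x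
      rw [h, Real.sSup_smul_of_nonneg (norm_nonneg c), smul_eq_mul]
    mul_le' := fun x y => ub _ _ fun p hp => (p.mul_le x y).trans
      (mul_le_mul (le x p hp) (le y p hp) (apply_nonneg _ _) (nn x))
    star_mul_self' := fun x => by
      refine le_antisymm (ub _ _ fun p hp => ?_) ?_
      · rw [p.star_mul_self]
        exact pow_le_pow_left₀ (apply_nonneg _ _) (le x p hp) 2
      · refine (Real.le_sqrt (nn x) (nn _)).1 (ub _ _ fun p hp => ?_)
        refine Real.le_sqrt_of_sq_le ?_
        rw [← p.star_mul_self]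
        exact le _ p hp }

theorem le_sup {S : Set (CStarSeminorm R)} {hne : S.Nonempty}
    {hb : ∀ x, BddAbove ((fun p : CStarSeminorm R => p x) '' S)} {p : CStarSeminorm R}
    (hp : p ∈ S) (x : R) : p x ≤ sup S hne hb x :=
  le_csSup (hb x) ⟨p, hp, rfl⟩

theorem sup_le {S : Set (CStarSeminorm R)} {hne : S.Nonempty}
    {hb : ∀ x, BddAbove ((fun p : CStarSeminorm R => p x) '' S)} {x : R} {c : ℝ}
    (h : ∀ p ∈ S, p x ≤ c) : sup S hne hb x ≤ c :=
  csSup_le (hne.image _) (by rintro _ ⟨p, hp, rfl⟩; exact h p hp)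

/-- A copy of the `*`-algebra `R`, carrying the seminorm `p`. -/
@[nolint unusedArguments]
def Pre (_ : CStarSeminorm R) : Type u := R

instance (p : CStarSeminorm R) : NonUnitalRing p.Pre := inferInstanceAs (NonUnitalRing R)
instance (p : CStarSeminorm R) : StarRing p.Pre := inferInstanceAs (StarRing R)
instance (p : CStarSeminorm R) : Module ℂ p.Pre := inferInstanceAs (Module ℂ R)

instance (p : CStarSeminorm R) : SeminormedAddCommGroup p.Pre :=
  fast_instance% p.toSeminorm.toAddGroupSeminorm.toSeminormedAddCommGroup

theorem norm_def (p : CStarSeminorm R) (x : p.Pre) : ‖x‖ = p x := rfl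

instance (p : CStarSeminorm R) : NormedSpace ℂ p.Pre where
  norm_smul_le c x := (map_smul_eq_mul p.toSeminorm c x).le

end

variable {R : Type u} [NonUnitalRing R] [StarRing R] [Module ℂ R]
  [IsScalarTower ℂ R R] [SMulCommClass ℂ R R] [StarModule ℂ R]

instance (p : CStarSeminorm R) : IsScalarTower ℂ p.Pre p.Pre :=
  inferInstanceAs (IsScalarTower ℂ R R)
instance (p : CStarSeminorm R) : SMulCommClass ℂ p.Pre p.Pre :=
  inferInstanceAs (SMulCommClass ℂ R R)
instance (p : CStarSeminorm R) : StarModule ℂ p.Pre := inferInstanceAs (StarModule ℂ R)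

/-- The `C*`-completion of a `*`-algebra `R` with respect to a `C*`-seminorm `p` (elements of
seminorm `0` are divided out). -/
def Completion (p : CStarSeminorm R) : Type u := UniformSpace.Completion p.Pre

set_option linter.unusedSectionVars false

namespace Completion

variable (p : CStarSeminorm R)

section Construction

@[reducible]
def normedAddCommGroup : NormedAddCommGroup p.Completion :=
  inferInstanceAs (NormedAddCommGroup (UniformSpace.Completion p.Pre))
attribute [local instance] normedAddCommGroup

@[reducible]
def normedSpace : NormedSpace ℂ p.Completion :=
  inferInstanceAs (NormedSpace ℂ (UniformSpace.Completion p.Pre))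
attribute [local instance] normedSpace

theorem completeSpace : CompleteSpace p.Completion :=
  inferInstanceAs (CompleteSpace (UniformSpace.Completion p.Pre))
attribute [local instance] completeSpace

/-- The canonical map of `R` to its completion. -/
def of : R →ₗ[ℂ] p.Completion :=
  (UniformSpace.Completion.toComplₗᵢ (𝕜 := ℂ) (E := p.Pre)).toLinearMap

theorem norm_of (x : R) : ‖of p x‖ = p x := UniformSpace.Completion.norm_coe (E := p.Pre) x

theorem denseRange_of : DenseRange (of p) :=
  UniformSpace.Completion.denseRange_coe (α := p.Pre)

variable {p} in
theorem induction {P : p.Completion → Prop} (x : p.Completion) (closed : IsClosed {x | P x})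
    (of : ∀ x, P (Completion.of p x)) : P x :=
  isClosed_property (denseRange_of p) closed of x

variable {p} in
theorem induction₂ {P : p.Completion → p.Completion → Prop} (x y : p.Completion)
    (closed : IsClosed {z : p.Completion × p.Completion | P z.1 z.2})
    (of : ∀ x y, P (Completion.of p x) (Completion.of p y)) : P x y :=
  isClosed_property2 (denseRange_of p) closed of x y

variable {p} in
theorem induction₃ {P : p.Completion → p.Completion → p.Completion → Prop}
    (x y z : p.Completion)
    (closed : IsClosed {w : p.Completion × p.Completion × p.Completion | P w.1 w.2.1 w.2.2})
    (of : ∀ x y z, P (Completion.of p x) (Completion.of p y) (Completion.of p z)) : P x y z :=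
  isClosed_property3 (denseRange_of p) closed of x y z

variable {F : Type v} [NormedAddCommGroup F] [NormedSpace ℂ F] [CompleteSpace F]
  {σ : ℂ →+* ℂ}

theorem extend_of [RingHomIsometric σ] (f : R →ₛₗ[σ] F) {C : ℝ} (h : ∀ x, ‖f x‖ ≤ C * p x)
    (x : R) : f.extendOfNorm (of p) (of p x) = f x :=
  LinearMap.extendOfNorm_eq (denseRange_of p) ⟨C, fun x => by rw [norm_of]; exact h x⟩ x

theorem norm_extend_le [RingHomIsometric σ] (f : R →ₛₗ[σ] F) {C : ℝ} (h : ∀ x, ‖f x‖ ≤ C * p x)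
    (x : p.Completion) : ‖f.extendOfNorm (of p) x‖ ≤ C * ‖x‖ :=
  LinearMap.norm_extendOfNorm_apply_le (denseRange_of p) C
    (fun x => by rw [norm_of]; exact h x) x

theorem norm_of_mul_le (x y : R) : ‖of p (x * y)‖ ≤ p x * p y :=
  (norm_of p _).trans_le (p.mul_le x y)

/-- Left multiplication by an element of `R`. -/
def mulLeftAux (x : R) : p.Completion →L[ℂ] p.Completion :=
  ((of p).comp (LinearMap.mul ℂ R x)).extendOfNorm (of p)

theorem mulLeftAux_of (x y : R) : mulLeftAux p x (of p y) = of p (x * y) :=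
  extend_of p ((of p).comp (LinearMap.mul ℂ R x)) (norm_of_mul_le p x) y

/-- Left multiplication by an element of `R`, linear in that element. -/
def mulLeft : R →ₗ[ℂ] p.Completion →L[ℂ] p.Completion where
  toFun := mulLeftAux p
  map_add' x y := by
    ext z
    induction z using induction with
    | closed => exact isClosed_eq (by fun_prop) (by fun_prop)
    | of z => simp only [add_apply, mulLeftAux_of, add_mul, map_add]
  map_smul' c x := by
    ext z
    induction z using induction with
    | closed => exact isClosed_eq (mulLeftAux p (c • x)).continuous (c • mulLeftAux p x).continuous
    | of z => simp only [RingHom.id_apply, smul_apply, mulLeftAux_of, smul_mul_assoc, map_smul]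

theorem mulLeft_of (x y : R) : mulLeft p x (of p y) = of p (x * y) := mulLeftAux_of p x y

theorem norm_mulLeft_le (x : R) : ‖mulLeft p x‖ ≤ 1 * p x := by
  rw [one_mul]
  exact ContinuousLinearMap.opNorm_le_bound _ (apply_nonneg _ _)
    (norm_extend_le p ((of p).comp (LinearMap.mul ℂ R x)) (norm_of_mul_le p x))

/-- Multiplication of the completion, as a continuous bilinear map. -/
def mulL : p.Completion →L[ℂ] p.Completion →L[ℂ] p.Completion :=
  (mulLeft p).extendOfNorm (of p)

@[reducible]
def hasMul : Mul p.Completion := ⟨fun x y => mulL p x y⟩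
attribute [local instance] hasMul

theorem mul_def (x y : p.Completion) : x * y = mulL p x y := rfl

theorem of_mul (x y : R) : of p (x * y) = of p x * of p y := by
  rw [mul_def, mulL, extend_of p _ (norm_mulLeft_le p), mulLeft_of]

theorem continuousMul : ContinuousMul p.Completion := ⟨(mulL p).continuous₂⟩
attribute [local instance] continuousMul

/-- The involution of the completion. -/
def starL : p.Completion →L⋆[ℂ] p.Completion :=
  ((of p).comp (starLinearEquiv ℂ (A := R)).toLinearMap).extendOfNorm (of p)

@[reducible]
def hasStar : Star p.Completion := ⟨starL p⟩
attribute [local instance] hasStar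

theorem of_star (x : R) : of p (star x) = star (of p x) :=
  (extend_of p ((of p).comp (starLinearEquiv ℂ (A := R)).toLinearMap) (C := 1)
    (fun x => by rw [one_mul]; exact ((norm_of p _).trans (p.star_eq x)).le) x).symm

theorem continuousStar : ContinuousStar p.Completion := ⟨(starL p).continuous⟩
attribute [local instance] continuousStar

@[reducible]
def nonUnitalNormedRing : NonUnitalNormedRing p.Completion where
  left_distrib x y z := map_add (mulL p x) y z
  right_distrib x y z := by simp [mul_def]
  zero_mul x := by simp [mul_def]
  mul_zero x := by simp [mul_def]
  mul_assoc x y z := by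
    induction x, y, z using induction₃ with
    | closed => exact isClosed_eq (by fun_prop) (by fun_prop)
    | of x y z =>
      simp only [← of_mul, mul_assoc]
  dist_eq x y := NormedAddCommGroup.dist_eq x y
  norm_mul_le x y := by
    induction x, y using induction₂ with
    | closed => exact isClosed_le (by fun_prop) (by fun_prop)
    | of x y =>
      rw [← of_mul, norm_of, norm_of, norm_of]
      exact p.mul_le x y
attribute [local instance] nonUnitalNormedRing

@[reducible]
def starRing : StarRing p.Completion where
  star_involutive x := by
    induction x using induction with
    | closed => exact isClosed_eq (by fun_prop) (by fun_prop)
    | of x =>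
      simp only [← of_star, star_star]
  star_mul x y := by
    induction x, y using induction₂ with
    | closed => exact isClosed_eq (by fun_prop) (by fun_prop)
    | of x y =>
      simp only [← of_star, ← of_mul, star_mul]
  star_add x y := map_add (starL p) x y
attribute [local instance] starRing

/-- The completion of a `*`-algebra with respect to a `C*`-seminorm is a `C*`-algebra. -/
instance : NonUnitalCStarAlgebra p.Completion where
  smul_assoc c x y := by
    change mulL p (c • x) y = c • mulL p x y
    simp
  smul_comm c x y := ((mulL p x).map_smul c y).symm
  star_smul c x := (starL p).map_smulₛₗ c x
  norm_mul_self_le x := by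
    induction x using induction with
    | closed => exact isClosed_le (by fun_prop) (by fun_prop)
    | of x =>
      rw [← of_star, ← of_mul, norm_of, norm_of, p.star_mul_self, sq]

end Construction

/-- The canonical `*`-homomorphism of `R` to its completion. -/
def ofHom : R →⋆ₙₐ[ℂ] p.Completion where
  toFun := of p
  map_smul' := map_smul (of p)
  map_zero' := map_zero (of p)
  map_add' := map_add (of p)
  map_mul' := of_mul p
  map_star' := of_star p

theorem ofHom_apply (x : R) : ofHom p x = of p x := rfl

variable {B : Type v} [NonUnitalCStarAlgebra B]

/-- The extension of a `*`-homomorphism `f : R → B` with `‖f x‖ ≤ p x` to the completion. -/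
def lift (f : R →⋆ₙₐ[ℂ] B) (h : ∀ x, ‖f x‖ ≤ p x) : p.Completion →⋆ₙₐ[ℂ] B :=
  let F := ((f : R →ₗ[ℂ] B)).extendOfNorm (of p)
  have hF : ∀ x, F (of p x) = f x :=
    extend_of p (f : R →ₗ[ℂ] B) (C := 1) (fun x => by rw [one_mul]; exact h x)
  { toFun := F
    map_smul' := fun c x => F.map_smul c x
    map_zero' := F.map_zero
    map_add' := fun x y => F.map_add x y
    map_mul' := fun x y => by
      induction x, y using induction₂ with
      | closed => exact isClosed_eq (by fun_prop) (by fun_prop)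
      | of x y =>
        rw [← of_mul, hF, hF, hF, map_mul]
    map_star' := fun x => by
      induction x using induction with
      | closed => exact isClosed_eq (by fun_prop) (by fun_prop)
      | of x =>
        rw [← of_star, hF, hF, map_star] }

theorem lift_of (f : R →⋆ₙₐ[ℂ] B) (h : ∀ x, ‖f x‖ ≤ p x) (x : R) : lift p f h (of p x) = f x :=
  extend_of p (f : R →ₗ[ℂ] B) (C := 1) (fun x => by rw [one_mul]; exact h x) x

end Completion

end CStarSeminorm

/-! ## The full group `C*`-algebra -/

section GroupAlgebra

variable (G : Type u) [Group G]

/-- The involution `c • s ↦ conj c • s⁻¹` of the group algebra. -/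
def groupAlgebraStar : MonoidAlgebra ℂ G →+ MonoidAlgebra ℂ G :=
  MonoidAlgebra.liftNC ((MonoidAlgebra.singleAddHom (1 : G)).comp (starAddEquiv (R := ℂ)).toAddMonoidHom)
    (fun s => MonoidAlgebra.single s⁻¹ 1)

variable {G} in
theorem groupAlgebraStar_single (s : G) (c : ℂ) :
    groupAlgebraStar G (MonoidAlgebra.single s c) = MonoidAlgebra.single s⁻¹ (star c) := by
  simp [groupAlgebraStar, MonoidAlgebra.liftNC_single, MonoidAlgebra.single_mul_single]

instance : StarRing (MonoidAlgebra ℂ G) where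
  star := groupAlgebraStar G
  star_involutive x := by
    induction x using MonoidAlgebra.induction_linear with
    | zero => simp
    | add x y hx hy => simp only [map_add, hx, hy]
    | single s c => simp only [groupAlgebraStar_single, star_star, inv_inv]
  star_mul x y := by
    induction x using MonoidAlgebra.induction_linear with
    | zero => simp
    | add x x' hx hx' => simp only [map_add, add_mul, mul_add, hx, hx']
    | single s c =>
      induction y using MonoidAlgebra.induction_linear with
      | zero => simp
      | add y y' hy hy' => simp only [map_add, add_mul, mul_add, hy, hy']
      | single t d =>
        simp only [MonoidAlgebra.single_mul_single, groupAlgebraStar_single, star_mul, mul_inv_rev]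
  star_add x y := map_add _ x y

variable {G} in
theorem MonoidAlgebra.star_single_complex (s : G) (c : ℂ) :
    star (MonoidAlgebra.single s c) = MonoidAlgebra.single s⁻¹ (star c) :=
  groupAlgebraStar_single s c

instance : StarModule ℂ (MonoidAlgebra ℂ G) where
  star_smul c x := by
    induction x using MonoidAlgebra.induction_linear with
    | zero => simp
    | add x y hx hy => simp only [smul_add, star_add, hx, hy]
    | single s d =>
      simp only [MonoidAlgebra.smul_single, MonoidAlgebra.star_single_complex, smul_eq_mul,
        star_mul']

theorem groupAlgebra_seminorm_bdd (x : MonoidAlgebra ℂ G) :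
    BddAbove ((fun p : CStarSeminorm (MonoidAlgebra ℂ G) => p x) '' Set.univ) := by
  suffices h : ∃ C : ℝ, ∀ p : CStarSeminorm (MonoidAlgebra ℂ G), p x ≤ C by
    obtain ⟨C, hC⟩ := h
    exact ⟨C, by rintro _ ⟨p, -, rfl⟩; exact hC p⟩
  induction x using MonoidAlgebra.induction_linear with
  | zero => exact ⟨0, fun p => (map_zero p.toSeminorm).le⟩
  | add x y hx hy =>
    obtain ⟨C, hC⟩ := hx
    obtain ⟨D, hD⟩ := hy
    exact ⟨C + D, fun p => (map_add_le_add p.toSeminorm x y).trans (add_le_add (hC p) (hD p))⟩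
  | single s c =>
    refine ⟨‖c‖, fun p => ?_⟩
    have h1 : p (MonoidAlgebra.single (1 : G) (1 : ℂ)) ≤ 1 := by
      have h := p.star_mul_self (MonoidAlgebra.single (1 : G) (1 : ℂ))
      simp only [MonoidAlgebra.star_single_complex, MonoidAlgebra.single_mul_single, inv_one,
        mul_one, star_one] at h
      nlinarith [apply_nonneg p.toSeminorm (MonoidAlgebra.single (1 : G) (1 : ℂ))]
    have h2 : p (MonoidAlgebra.single s (1 : ℂ)) ≤ 1 := by
      have h := p.star_mul_self (MonoidAlgebra.single s (1 : ℂ))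
      simp only [MonoidAlgebra.star_single_complex, MonoidAlgebra.single_mul_single,
        inv_mul_cancel, mul_one, star_one] at h
      nlinarith [apply_nonneg p.toSeminorm (MonoidAlgebra.single s (1 : ℂ))]
    have h3 : MonoidAlgebra.single s c = c • MonoidAlgebra.single s (1 : ℂ) := by simp
    rw [h3, map_smul_eq_mul]
    exact mul_le_of_le_one_right (norm_nonneg c) h2

/-- The largest `C*`-seminorm on the group algebra `ℂ[G]`, that is, the supremum of `‖π x‖` over
all `*`-representations `π` of `ℂ[G]`. -/
def maxSeminorm : CStarSeminorm (MonoidAlgebra ℂ G) :=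
  CStarSeminorm.sup Set.univ
    ⟨CStarSeminorm.ofHom (0 : MonoidAlgebra ℂ G →⋆ₙₐ[ℂ] ℂ), Set.mem_univ _⟩
    (groupAlgebra_seminorm_bdd G)

/-- The full group `C*`-algebra `C*(G)` of the discrete group `G`: the completion of `ℂ[G]` in its
largest `C*`-seminorm. -/
def GroupCStar : Type u := (maxSeminorm G).Completion

instance : NonUnitalCStarAlgebra (GroupCStar G) :=
  inferInstanceAs (NonUnitalCStarAlgebra (maxSeminorm G).Completion)

namespace GroupCStar

variable {G}

/-- The canonical `*`-homomorphism `ℂ[G] → C*(G)`. -/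
def ofAlg : MonoidAlgebra ℂ G →⋆ₙₐ[ℂ] GroupCStar G :=
  CStarSeminorm.Completion.ofHom (maxSeminorm G)

theorem denseRange_ofAlg : DenseRange (ofAlg (G := G)) :=
  CStarSeminorm.Completion.denseRange_of (maxSeminorm G)

/-- The canonical image of `s : G` in `C*(G)`. -/
def of (s : G) : GroupCStar G := ofAlg (MonoidAlgebra.single s 1)

theorem of_mul_of (s t : G) : of s * of t = of (s * t) := by
  rw [of, of, ← map_mul, MonoidAlgebra.single_mul_single, one_mul]; rfl

theorem star_of (s : G) : star (of s) = of s⁻¹ := by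
  rw [of, ← map_star, MonoidAlgebra.star_single_complex, star_one]; rfl

theorem of_one_mul (x : GroupCStar G) : of 1 * x = x := by
  refine denseRange_ofAlg.induction_on x (isClosed_eq (by fun_prop) (by fun_prop)) fun x => ?_
  rw [of, ← map_mul, ← MonoidAlgebra.one_def, one_mul]

theorem mul_of_one (x : GroupCStar G) : x * of 1 = x := by
  refine denseRange_ofAlg.induction_on x (isClosed_eq (by fun_prop) (by fun_prop)) fun x => ?_
  rw [of, ← map_mul, ← MonoidAlgebra.one_def, mul_one]

variable {B : Type v} [NonUnitalCStarAlgebra B]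

/-- The `*`-homomorphism `ℂ[G] → B` given by a multiplicative map `π : G → B` with
`π s⁻¹ = (π s)*`. -/
def liftAlg (π : G →ₙ* B) (hπ : ∀ s, π s⁻¹ = star (π s)) : MonoidAlgebra ℂ G →⋆ₙₐ[ℂ] B where
  __ := MonoidAlgebra.liftMagma ℂ π
  map_star' x := by
    change MonoidAlgebra.liftMagma ℂ π (star x) = star (MonoidAlgebra.liftMagma ℂ π x)
    induction x using MonoidAlgebra.induction_linear with
    | zero => simp
    | add x y hx hy => simp only [map_add, star_add, hx, hy]
    | single s c =>
      simp [MonoidAlgebra.star_single_complex, hπ]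

theorem liftAlg_single (π : G →ₙ* B) (hπ : ∀ s, π s⁻¹ = star (π s)) (s : G) :
    liftAlg π hπ (MonoidAlgebra.single s 1) = π s := by
  change MonoidAlgebra.liftMagma ℂ π _ = _
  simp

/-- The `*`-homomorphism `C*(G) → B` given by a multiplicative map `π : G → B` with
`π s⁻¹ = (π s)*`. -/
def lift (π : G →ₙ* B) (hπ : ∀ s, π s⁻¹ = star (π s)) : GroupCStar G →⋆ₙₐ[ℂ] B :=
  CStarSeminorm.Completion.lift (maxSeminorm G) (liftAlg π hπ) fun x =>
    CStarSeminorm.le_sup (p := CStarSeminorm.ofHom (liftAlg π hπ)) (Set.mem_univ _) x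

theorem lift_of (π : G →ₙ* B) (hπ : ∀ s, π s⁻¹ = star (π s)) (s : G) :
    lift π hπ (of s) = π s :=
  (CStarSeminorm.Completion.lift_of _ _ _ _).trans (liftAlg_single π hπ s)

end GroupCStar

end GroupAlgebra

/-! ## The minimal (spatial) tensor product of `C*`-algebras -/

section Tensor

/-- The algebraic tensor product of two `*`-algebras is a `*`-algebra. -/
instance TensorProduct.nonUnitalStarRing {A B : Type*} [NonUnitalCStarAlgebra A]
    [NonUnitalCStarAlgebra B] : StarRing (A ⊗[ℂ] B) where
  star_mul x y := by
    induction x using TensorProduct.induction_on with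
    | zero => simp
    | add x x' hx hx' => simp only [add_mul, mul_add, star_add, hx, hx']
    | tmul a b =>
      induction y using TensorProduct.induction_on with
      | zero => simp
      | add y y' hy hy' => simp only [add_mul, mul_add, star_add, hy, hy']
      | tmul c d => simp
  star_add x y := star_add x y

/-- The Hilbert space tensor product of two Hilbert spaces. -/
def HilbertTensor (H K : Type u) [NormedAddCommGroup H] [InnerProductSpace ℂ H]
    [NormedAddCommGroup K] [InnerProductSpace ℂ K] : Type u :=
  UniformSpace.Completion (H ⊗[ℂ] K)

namespace HilbertTensor

section
variable (H K : Type u) [NormedAddCommGroup H] [InnerProductSpace ℂ H]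
  [NormedAddCommGroup K] [InnerProductSpace ℂ K]

instance : NormedAddCommGroup (HilbertTensor H K) :=
  inferInstanceAs (NormedAddCommGroup (UniformSpace.Completion (H ⊗[ℂ] K)))
instance : InnerProductSpace ℂ (HilbertTensor H K) :=
  inferInstanceAs (InnerProductSpace ℂ (UniformSpace.Completion (H ⊗[ℂ] K)))
instance : CompleteSpace (HilbertTensor H K) :=
  inferInstanceAs (CompleteSpace (UniformSpace.Completion (H ⊗[ℂ] K)))

/-- The inclusion of the algebraic tensor product into the Hilbert space tensor product. -/
def incl : H ⊗[ℂ] K →ₗᵢ[ℂ] HilbertTensor H K :=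
  UniformSpace.Completion.toComplₗᵢ

theorem denseRange_incl : DenseRange (incl H K) :=
  UniformSpace.Completion.denseRange_coe

end

variable {H K : Type u} [NormedAddCommGroup H] [InnerProductSpace ℂ H]
  [NormedAddCommGroup K] [InnerProductSpace ℂ K]

/-- The operator `S ⊗ T` on the Hilbert space tensor product. -/
def op (S : H →L[ℂ] H) (T : K →L[ℂ] K) : HilbertTensor H K →L[ℂ] HilbertTensor H K :=
  ((incl H K).toLinearMap.comp (TensorProduct.mapL S T).toLinearMap).extendOfNorm
    (incl H K).toLinearMap

theorem norm_mapL_le (S : H →L[ℂ] H) (T : K →L[ℂ] K) (v : H ⊗[ℂ] K) :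
    ‖incl H K (TensorProduct.mapL S T v)‖ ≤ ‖S‖ * ‖T‖ * ‖incl H K v‖ := by
  rw [LinearIsometry.norm_map, LinearIsometry.norm_map]
  refine (ContinuousLinearMap.le_opNorm _ v).trans ?_
  gcongr
  exact TensorProduct.norm_mapL_le _ _

theorem op_incl (S : H →L[ℂ] H) (T : K →L[ℂ] K) (v : H ⊗[ℂ] K) :
    op S T (incl H K v) = incl H K (TensorProduct.mapL S T v) :=
  LinearMap.extendOfNorm_eq (denseRange_incl H K) ⟨‖S‖ * ‖T‖, norm_mapL_le S T⟩ v

theorem ext_incl {f g : HilbertTensor H K →L[ℂ] HilbertTensor H K}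
    (h : ∀ v, f (incl H K v) = g (incl H K v)) : f = g :=
  DFunLike.coe_injective
    ((denseRange_incl H K).equalizer f.continuous g.continuous (funext h))

theorem norm_op_le (S : H →L[ℂ] H) (T : K →L[ℂ] K) : ‖op S T‖ ≤ ‖S‖ * ‖T‖ :=
  LinearMap.opNorm_extendOfNorm_le (denseRange_incl H K) (by positivity) (norm_mapL_le S T)

/-- The operator `S ⊗ T`, as a bilinear map. -/
def opBilin : (H →L[ℂ] H) →ₗ[ℂ] (K →L[ℂ] K) →ₗ[ℂ]
    (HilbertTensor H K →L[ℂ] HilbertTensor H K) :=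
  LinearMap.mk₂ ℂ op
    (fun a a' b => ext_incl fun v => by
      simp only [add_apply, op_incl, map_add, TensorProduct.mapL_add_left])
    (fun c a b => ext_incl fun v => by
      simp only [smul_apply, op_incl, map_smul, TensorProduct.mapL_smul_left])
    (fun a b b' => ext_incl fun v => by
      simp only [add_apply, op_incl, map_add, TensorProduct.mapL_add_right])
    (fun c a b => ext_incl fun v => by
      simp only [smul_apply, op_incl, map_smul, TensorProduct.mapL_smul_right])

theorem opBilin_apply (S : H →L[ℂ] H) (T : K →L[ℂ] K) : opBilin S T = op S T := rfl

theorem op_mul (S S' : H →L[ℂ] H) (T T' : K →L[ℂ] K) :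
    op (S * S') (T * T') = op S T * op S' T' :=
  ext_incl fun v => by
    rw [mul_apply_eq_comp, op_incl, op_incl, op_incl, TensorProduct.mapL_mul, mul_apply_eq_comp]

theorem inner_mapL_star [CompleteSpace H] [CompleteSpace K] (S : H →L[ℂ] H) (T : K →L[ℂ] K)
    (v w : H ⊗[ℂ] K) :
    inner ℂ (TensorProduct.mapL (star S) (star T) v) w =
      inner ℂ v (TensorProduct.mapL S T w) := by
  induction v using TensorProduct.induction_on with
  | zero => simp
  | add v v' hv hv' => simp only [map_add, inner_add_left, hv, hv']
  | tmul h k =>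
    induction w using TensorProduct.induction_on with
    | zero => simp
    | add w w' hw hw' => simp only [map_add, inner_add_right, hw, hw']
    | tmul h' k' =>
      rw [TensorProduct.mapL_tmul, TensorProduct.mapL_tmul, TensorProduct.inner_tmul,
        TensorProduct.inner_tmul, ContinuousLinearMap.star_eq_adjoint,
        ContinuousLinearMap.star_eq_adjoint, ContinuousLinearMap.adjoint_inner_left,
        ContinuousLinearMap.adjoint_inner_left]

theorem op_star [CompleteSpace H] [CompleteSpace K] (S : H →L[ℂ] H) (T : K →L[ℂ] K) :
    op (star S) (star T) = star (op S T) := by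
  rw [ContinuousLinearMap.star_eq_adjoint (A := op S T), ContinuousLinearMap.eq_adjoint_iff]
  intro v w
  refine (denseRange_incl H K).induction_on₂
    (p := fun v w => inner ℂ (op (star S) (star T) v) w = inner ℂ v (op S T w))
    (isClosed_eq (by fun_prop) (by fun_prop)) (fun v w => ?_) v w
  rw [op_incl, op_incl, LinearIsometry.inner_map_map, LinearIsometry.inner_map_map,
    inner_mapL_star]

end HilbertTensor

/-- A representation of a `C*`-algebra on a Hilbert space. -/
structure CStarRep (A : Type u) [NonUnitalCStarAlgebra A] where
  space : Type u
  [normedAddCommGroup : NormedAddCommGroup space]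
  [innerProductSpace : InnerProductSpace ℂ space]
  [completeSpace : CompleteSpace space]
  hom : A →⋆ₙₐ[ℂ] (space →L[ℂ] space)

attribute [instance] CStarRep.normedAddCommGroup CStarRep.innerProductSpace
  CStarRep.completeSpace

variable {A B A' B' : Type u} [NonUnitalCStarAlgebra A] [NonUnitalCStarAlgebra B]
  [NonUnitalCStarAlgebra A'] [NonUnitalCStarAlgebra B']

namespace CStarRep

/-- The linear map `a ⊗ b ↦ π(a) ⊗ ρ(b)` on the algebraic tensor product. -/
def tensorLinear (π : CStarRep A) (ρ : CStarRep B) :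
    A ⊗[ℂ] B →ₗ[ℂ] (HilbertTensor π.space ρ.space →L[ℂ] HilbertTensor π.space ρ.space) :=
  TensorProduct.lift (HilbertTensor.opBilin.compl₁₂ (π.hom : A →ₗ[ℂ] (π.space →L[ℂ] π.space))
    (ρ.hom : B →ₗ[ℂ] (ρ.space →L[ℂ] ρ.space)))

theorem tensorLinear_tmul (π : CStarRep A) (ρ : CStarRep B) (a : A) (b : B) :
    π.tensorLinear ρ (a ⊗ₜ b) = HilbertTensor.op (π.hom a) (ρ.hom b) := rfl

/-- The `*`-homomorphism `a ⊗ b ↦ π(a) ⊗ ρ(b)` on the algebraic tensor product. -/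
def tensorAlg (π : CStarRep A) (ρ : CStarRep B) :
    A ⊗[ℂ] B →⋆ₙₐ[ℂ] (HilbertTensor π.space ρ.space →L[ℂ] HilbertTensor π.space ρ.space) where
  toFun := π.tensorLinear ρ
  map_smul' := map_smul (π.tensorLinear ρ)
  map_zero' := map_zero (π.tensorLinear ρ)
  map_add' := map_add (π.tensorLinear ρ)
  map_mul' x y := by
    induction x using TensorProduct.induction_on with
    | zero => simp
    | add x x' hx hx' => simp only [add_mul, map_add, hx, hx']
    | tmul a b =>
      induction y using TensorProduct.induction_on with
      | zero => simp
      | add y y' hy hy' => simp only [mul_add, map_add, hy, hy']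
      | tmul c d =>
        simp only [Algebra.TensorProduct.tmul_mul_tmul, tensorLinear_tmul, map_mul,
          HilbertTensor.op_mul]
  map_star' x := by
    induction x using TensorProduct.induction_on with
    | zero => simp
    | add x x' hx hx' => simp only [star_add, map_add, hx, hx']
    | tmul a b => simp only [TensorProduct.star_tmul, tensorLinear_tmul, map_star, HilbertTensor.op_star]

theorem tensorAlg_tmul (π : CStarRep A) (ρ : CStarRep B) (a : A) (b : B) :
    π.tensorAlg ρ (a ⊗ₜ b) = HilbertTensor.op (π.hom a) (ρ.hom b) := rfl

/-- The `C*`-seminorm `x ↦ ‖(π ⊗ ρ)(x)‖` on the algebraic tensor product. -/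
def tensorSeminorm (π : CStarRep A) (ρ : CStarRep B) : CStarSeminorm (A ⊗[ℂ] B) :=
  CStarSeminorm.ofHom (π.tensorAlg ρ)

theorem tensorSeminorm_apply (π : CStarRep A) (ρ : CStarRep B) (x : A ⊗[ℂ] B) :
    π.tensorSeminorm ρ x = ‖π.tensorAlg ρ x‖ := rfl

/-- The zero representation on the zero space. -/
instance : Inhabited (CStarRep A) where
  default := { space := EuclideanSpace ℂ PEmpty.{u + 1}, hom := 0 }

/-- The composition of a representation with a `*`-homomorphism. -/
abbrev comp (π : CStarRep A') (φ : A →⋆ₙₐ[ℂ] A') : CStarRep A where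
  space := π.space
  hom := π.hom.comp φ

end CStarRep

variable (A B)

theorem tensor_seminorm_bdd (x : A ⊗[ℂ] B) :
    BddAbove ((fun p : CStarSeminorm (A ⊗[ℂ] B) => p x) '' Set.range
      fun z : CStarRep A × CStarRep B => z.1.tensorSeminorm z.2) := by
  suffices h : ∃ C : ℝ, ∀ (π : CStarRep A) (ρ : CStarRep B),
      ‖π.tensorAlg ρ x‖ ≤ C by
    obtain ⟨C, hC⟩ := h
    exact ⟨C, by rintro _ ⟨_, ⟨z, rfl⟩, rfl⟩; exact hC z.1 z.2⟩
  induction x using TensorProduct.induction_on with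
  | zero => exact ⟨0, fun π ρ => by simp⟩
  | tmul a b => exact ⟨‖a‖ * ‖b‖, fun π ρ => (HilbertTensor.norm_op_le _ _).trans
    (mul_le_mul (NonUnitalStarAlgHom.norm_apply_le π.hom a)
      (NonUnitalStarAlgHom.norm_apply_le ρ.hom b) (norm_nonneg _) (norm_nonneg _))⟩
  | add x y hx hy =>
    obtain ⟨C, hC⟩ := hx
    obtain ⟨D, hD⟩ := hy
    refine ⟨C + D, fun π ρ => ?_⟩
    rw [map_add]
    exact (norm_add_le _ _).trans (add_le_add (hC π ρ) (hD π ρ))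

/-- The minimal (spatial) `C*`-seminorm on the algebraic tensor product: the supremum of
`‖(π ⊗ ρ)(x)‖` over all representations `π` of `A` and `ρ` of `B` on Hilbert spaces. -/
def minSeminorm : CStarSeminorm (A ⊗[ℂ] B) :=
  CStarSeminorm.sup
    (Set.range fun z : CStarRep A × CStarRep B =>
      z.1.tensorSeminorm z.2)
    (Set.range_nonempty _) (tensor_seminorm_bdd A B)

/-- The minimal (spatial) tensor product of two `C*`-algebras. -/
def SpatialTensor : Type u := (minSeminorm A B).Completion

instance : NonUnitalCStarAlgebra (SpatialTensor A B) :=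
  inferInstanceAs (NonUnitalCStarAlgebra (minSeminorm A B).Completion)

variable {A B}

theorem le_minSeminorm (π : CStarRep A) (ρ : CStarRep B) (x : A ⊗[ℂ] B) :
    ‖π.tensorAlg ρ x‖ ≤ minSeminorm A B x :=
  CStarSeminorm.le_sup (p := π.tensorSeminorm ρ) (Set.mem_range_self (f := fun z :
    CStarRep A × CStarRep B => z.1.tensorSeminorm z.2) (π, ρ)) x

namespace SpatialTensor

/-- The canonical `*`-homomorphism of the algebraic to the spatial tensor product. -/
def ofAlg : A ⊗[ℂ] B →⋆ₙₐ[ℂ] SpatialTensor A B :=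
  CStarSeminorm.Completion.ofHom (minSeminorm A B)

theorem norm_ofAlg (x : A ⊗[ℂ] B) : ‖ofAlg x‖ = minSeminorm A B x :=
  CStarSeminorm.Completion.norm_of (minSeminorm A B) x

theorem denseRange_ofAlg : DenseRange (ofAlg (A := A) (B := B)) :=
  CStarSeminorm.Completion.denseRange_of (minSeminorm A B)

/-- The extension to the spatial tensor product of a `*`-homomorphism on the algebraic tensor
product that is contractive for the spatial norm. -/
def lift {D : Type v} [NonUnitalCStarAlgebra D] (f : A ⊗[ℂ] B →⋆ₙₐ[ℂ] D)
    (h : ∀ x, ‖f x‖ ≤ minSeminorm A B x) : SpatialTensor A B →⋆ₙₐ[ℂ] D :=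
  CStarSeminorm.Completion.lift (minSeminorm A B) f h

theorem lift_ofAlg {D : Type v} [NonUnitalCStarAlgebra D] (f : A ⊗[ℂ] B →⋆ₙₐ[ℂ] D)
    (h : ∀ x, ‖f x‖ ≤ minSeminorm A B x) (x : A ⊗[ℂ] B) : lift f h (ofAlg x) = f x :=
  CStarSeminorm.Completion.lift_of (minSeminorm A B) f h x

/-- The elementary tensor `a ⊗ b`. -/
def tmul (a : A) (b : B) : SpatialTensor A B := ofAlg (a ⊗ₜ b)

theorem tmul_mul_tmul (a a' : A) (b b' : B) :
    tmul a b * tmul a' b' = tmul (a * a') (b * b') := by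
  rw [tmul, tmul, ← map_mul, Algebra.TensorProduct.tmul_mul_tmul]; rfl

theorem star_tmul (a : A) (b : B) : star (tmul a b) = tmul (star a) (star b) := by
  rw [tmul, ← map_star, TensorProduct.star_tmul]; rfl

theorem norm_tmul_le (a : A) (b : B) : ‖tmul a b‖ ≤ ‖a‖ * ‖b‖ := by
  refine (norm_ofAlg _).trans_le (CStarSeminorm.sup_le ?_)
  rintro _ ⟨⟨π, ρ⟩, rfl⟩
  exact (HilbertTensor.norm_op_le _ _).trans
    (mul_le_mul (NonUnitalStarAlgHom.norm_apply_le π.hom _)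
      (NonUnitalStarAlgHom.norm_apply_le ρ.hom _) (norm_nonneg _) (norm_nonneg _))

end SpatialTensor

/-- The representation `π ⊗ ρ` of the spatial tensor product on the Hilbert space tensor
product. -/
def CStarRep.tensor (π : CStarRep A) (ρ : CStarRep B) :
    CStarRep (SpatialTensor A B) where
  space := HilbertTensor π.space ρ.space
  hom := SpatialTensor.lift (π.tensorAlg ρ) (le_minSeminorm π ρ)

namespace SpatialTensor

/-- The algebraic tensor product of two `*`-homomorphisms. -/
def mapAlg (φ : A →⋆ₙₐ[ℂ] A') (ψ : B →⋆ₙₐ[ℂ] B') : A ⊗[ℂ] B →⋆ₙₐ[ℂ] A' ⊗[ℂ] B' where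
  toFun := TensorProduct.map (φ : A →ₗ[ℂ] A') (ψ : B →ₗ[ℂ] B')
  map_smul' c x := map_smul _ c x
  map_zero' := map_zero _
  map_add' x y := map_add _ x y
  map_mul' x y := by
    induction x using TensorProduct.induction_on with
    | zero => simp
    | add x x' hx hx' => simp only [add_mul, map_add, hx, hx']
    | tmul a b =>
      induction y using TensorProduct.induction_on with
      | zero => simp
      | add y y' hy hy' => simp only [mul_add, map_add, hy, hy']
      | tmul c d => simp
  map_star' x := by
    induction x using TensorProduct.induction_on with
    | zero => simp
    | add x x' hx hx' => simp only [star_add, map_add, hx, hx']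
    | tmul a b => simp [map_star]

theorem mapAlg_tmul (φ : A →⋆ₙₐ[ℂ] A') (ψ : B →⋆ₙₐ[ℂ] B') (a : A) (b : B) :
    mapAlg φ ψ (a ⊗ₜ b) = φ a ⊗ₜ ψ b := rfl

theorem tensorLinear_comp_map (φ : A →⋆ₙₐ[ℂ] A') (ψ : B →⋆ₙₐ[ℂ] B') (π : CStarRep A')
    (ρ : CStarRep B') :
    (π.tensorLinear ρ).comp (TensorProduct.map (φ : A →ₗ[ℂ] A') (ψ : B →ₗ[ℂ] B')) =
      (π.comp φ).tensorLinear (ρ.comp ψ) :=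
  TensorProduct.ext' fun _ _ => rfl

theorem norm_tensorAlg_mapAlg (φ : A →⋆ₙₐ[ℂ] A') (ψ : B →⋆ₙₐ[ℂ] B') (π : CStarRep A')
    (ρ : CStarRep B') (x : A ⊗[ℂ] B) :
    ‖π.tensorAlg ρ (mapAlg φ ψ x)‖ = ‖(π.comp φ).tensorAlg (ρ.comp ψ) x‖ :=
  congrArg norm (LinearMap.congr_fun (tensorLinear_comp_map φ ψ π ρ) x)

/-- The `*`-homomorphism `φ ⊗ ψ` between spatial tensor products. -/
def map (φ : A →⋆ₙₐ[ℂ] A') (ψ : B →⋆ₙₐ[ℂ] B') : SpatialTensor A B →⋆ₙₐ[ℂ] SpatialTensor A' B' :=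
  lift (ofAlg.comp (mapAlg φ ψ)) fun x => by
    rw [NonUnitalStarAlgHom.comp_apply, norm_ofAlg]
    refine CStarSeminorm.sup_le ?_
    rintro _ ⟨⟨π, ρ⟩, rfl⟩
    rw [CStarRep.tensorSeminorm_apply, norm_tensorAlg_mapAlg]
    exact le_minSeminorm (π.comp φ) (ρ.comp ψ) x

theorem map_tmul (φ : A →⋆ₙₐ[ℂ] A') (ψ : B →⋆ₙₐ[ℂ] B') (a : A) (b : B) :
    map φ ψ (tmul a b) = tmul (φ a) (ψ b) :=
  lift_ofAlg _ _ _

/-- The Hilbert space vector `h ⊗ k`. -/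
def vec (π : CStarRep A) (ρ : CStarRep B) (h : π.space) (k : ρ.space) :
    (π.tensor ρ).space :=
  HilbertTensor.incl π.space ρ.space (h ⊗ₜ[ℂ] k)

variable {C : Type u} [NonUnitalCStarAlgebra C]

/-- `x : (A ⊗ B) ⊗ C` and `y : A ⊗ (B ⊗ C)` are the same element of the threefold spatial tensor
product `A ⊗ B ⊗ C`: for all representations `π`, `ρ`, `σ` of `A`, `B`, `C` on `H`, `K`, `L`, the
operators `((π ⊗ ρ) ⊗ σ)(x)` on `(H ⊗ K) ⊗ L` and `(π ⊗ (ρ ⊗ σ))(y)` on `H ⊗ (K ⊗ L)` agree under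
the identification `(h ⊗ k) ⊗ l ↔ h ⊗ (k ⊗ l)`, that is, they have the same matrix coefficients
at the (total) elementary tensors. -/
def AssocEq (x : SpatialTensor (SpatialTensor A B) C) (y : SpatialTensor A (SpatialTensor B C)) :
    Prop :=
  ∀ (π : CStarRep A) (ρ : CStarRep B) (σ : CStarRep C)
    (h h' : π.space) (k k' : ρ.space) (l l' : σ.space),
    inner ℂ (vec (π.tensor ρ) σ (vec π ρ h k) l)
        (((π.tensor ρ).tensor σ).hom x (vec (π.tensor ρ) σ (vec π ρ h' k') l')) =
      inner ℂ (vec π (ρ.tensor σ) h (vec ρ σ k l))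
        ((π.tensor (ρ.tensor σ)).hom y (vec π (ρ.tensor σ) h' (vec ρ σ k' l')))

end SpatialTensor

end Tensor

/-! ## Multipliers of `C*`-algebras -/

namespace DoubleCentralizer

section Extend

variable {A : Type u} {T : Type v} [NonUnitalCStarAlgebra A] [NonUnitalCStarAlgebra T]

theorem eq_of_mul_left {d e : T} (h : ∀ x, d * x = e * x) : d = e := by
  rw [← sub_eq_zero, ← CStarRing.mul_star_self_eq_zero_iff, sub_mul, h, sub_self]

theorem eq_of_mul_right {d e : T} (h : ∀ x, x * d = x * e) : d = e := by
  rw [← sub_eq_zero, ← CStarRing.star_mul_self_eq_zero_iff, mul_sub, h, sub_self]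

theorem fst_mul (v : 𝓜(ℂ, T)) (x y : T) : v.fst (x * y) = v.fst x * y :=
  eq_of_mul_right fun w => by
    rw [← v.central, ← mul_assoc, ← mul_assoc, v.central]

theorem ext_fst {v w : 𝓜(ℂ, T)} (h : ∀ x, v.fst x = w.fst x) : v = w := by
  refine DoubleCentralizer.ext ℂ T v w (Prod.ext (ContinuousLinearMap.ext h)
    (ContinuousLinearMap.ext fun x => eq_of_mul_left fun y => ?_))
  rw [v.central, w.central, h]

theorem coe_mem_unitary (w : T) (h : ∀ x, star w * (w * x) = x) (h' : ∀ x, w * (star w * x) = x) :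
    DoubleCentralizer.coe ℂ w ∈ unitary 𝓜(ℂ, T) := by
  rw [Unitary.mem_iff]
  constructor <;> refine ext_fst fun x => ?_
  · rw [mul_fst, mul_apply_eq_comp, star_fst]
    change star (star (w * x) * w) = x
    rw [star_mul, star_star, h]
  · rw [mul_fst, mul_apply_eq_comp, star_fst]
    change w * star (star x * w) = x
    rw [star_mul, star_star, h']

/-- `φ : A → T` is nondegenerate: the closed linear span of `φ(A)T` is `T`. -/
def Nondegenerate (φ : A →⋆ₙₐ[ℂ] T) : Prop :=
  (Submodule.span ℂ {z | ∃ a x, z = φ a * x}).topologicalClosure = ⊤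

variable (φ : A →⋆ₙₐ[ℂ] T) (m : 𝓜(ℂ, A))

/-- The linear map `a ⊗ x ↦ φ(a) x` on the algebraic tensor product. -/
def actLinear : A ⊗[ℂ] T →ₗ[ℂ] T :=
  TensorProduct.lift ((LinearMap.mul ℂ T).comp (φ : A →ₗ[ℂ] T))

theorem actLinear_tmul (a : A) (x : T) : actLinear φ (a ⊗ₜ x) = φ a * x := rfl

/-- The linear map `a ⊗ x ↦ φ(m a) x` on the algebraic tensor product. -/
def actMulLinear : A ⊗[ℂ] T →ₗ[ℂ] T :=
  TensorProduct.lift ((LinearMap.mul ℂ T).comp ((φ : A →ₗ[ℂ] T).comp m.fst.toLinearMap))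

theorem actMulLinear_tmul (a : A) (x : T) : actMulLinear φ m (a ⊗ₜ x) = φ (m.fst a) * x := rfl

theorem denseRange_actLinear (hφ : Nondegenerate φ) : DenseRange (actLinear φ) := by
  have h : (LinearMap.range (actLinear φ)).topologicalClosure = ⊤ := by
    refine top_le_iff.1 (hφ.symm.le.trans (Submodule.topologicalClosure_mono
      (Submodule.span_le.2 ?_)))
    rintro _ ⟨a, x, rfl⟩
    exact ⟨a ⊗ₜ x, rfl⟩
  exact (Submodule.dense_iff_topologicalClosure_eq_top).2 h

theorem map_mul_actMulLinear (a : A) (w : A ⊗[ℂ] T) :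
    φ a * actMulLinear φ m w = φ (m.snd a) * actLinear φ w := by
  induction w using TensorProduct.induction_on with
  | zero => simp
  | add w w' hw hw' => simp only [map_add, mul_add, hw, hw']
  | tmul b x =>
    rw [actMulLinear_tmul, actLinear_tmul, ← mul_assoc, ← mul_assoc, ← map_mul, ← map_mul,
      m.central]

theorem norm_actMulLinear_le (w : A ⊗[ℂ] T) :
    ‖actMulLinear φ m w‖ ≤ ‖m.snd‖ * ‖actLinear φ w‖ := by
  let _ := CStarAlgebra.spectralOrder A
  have _ := CStarAlgebra.spectralOrderedRing A
  have hu := CStarAlgebra.increasingApproximateUnit A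
  have := hu.neBot
  have ht : Filter.Tendsto (fun e => φ e * actMulLinear φ m w) (CStarAlgebra.approximateUnit A)
      (nhds (actMulLinear φ m w)) := by
    induction w using TensorProduct.induction_on with
    | zero => simp
    | add w w' hw hw' => simpa only [map_add, mul_add] using hw.add hw'
    | tmul b x =>
      simp only [actMulLinear_tmul, ← mul_assoc, ← map_mul]
      have hc : Continuous φ := AddMonoidHomClass.continuous_of_bound φ 1 fun a => by
        rw [one_mul]; exact NonUnitalStarAlgHom.norm_apply_le φ a
      exact ((hc.tendsto _).comp (hu.tendsto_mul_right (m.fst b))).mul_const x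
  refine le_of_tendsto ht.norm ?_
  filter_upwards [hu.eventually_norm] with e he
  rw [map_mul_actMulLinear]
  refine (norm_mul_le _ _).trans (mul_le_mul_of_nonneg_right ?_ (norm_nonneg _))
  refine (NonUnitalStarAlgHom.norm_apply_le φ _).trans ((m.snd.le_opNorm e).trans ?_)
  exact mul_le_of_le_one_right (norm_nonneg _) he

/-- The left multiplication `φ(a) x ↦ φ(m a) x` by the extension of `φ` to multipliers. -/
def extendLeft : T →L[ℂ] T := (actMulLinear φ m).extendOfNorm (actLinear φ)

variable {φ}

theorem extendLeft_apply (hφ : Nondegenerate φ) (w : A ⊗[ℂ] T) :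
    extendLeft φ m (actLinear φ w) = actMulLinear φ m w :=
  LinearMap.extendOfNorm_eq (denseRange_actLinear φ hφ) ⟨_, norm_actMulLinear_le φ m⟩ w

theorem map_mul_extendLeft (hφ : Nondegenerate φ) (a : A) (z : T) :
    φ a * extendLeft φ m z = φ (m.snd a) * z := by
  refine (denseRange_actLinear φ hφ).induction_on z (isClosed_eq (by fun_prop) (by fun_prop)) ?_
  intro w
  rw [extendLeft_apply m hφ, map_mul_actMulLinear]

/-- The extension of a nondegenerate `*`-homomorphism `φ : A → T` to the multiplier algebras:
`extend hφ m` is the unique multiplier of `T` with `(extend hφ m) φ(a) = φ(m a)` for all `a`. -/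
def extend (hφ : Nondegenerate φ) (m : 𝓜(ℂ, A)) : 𝓜(ℂ, T) where
  fst := extendLeft φ m
  snd := ((starL ℂ : T ≃L⋆[ℂ] T) : T →L⋆[ℂ] T).comp
    ((extendLeft φ (star m)).comp ((starL ℂ : T ≃L⋆[ℂ] T) : T →L⋆[ℂ] T))
  central x y := by
    change star (extendLeft φ (star m) (star x)) * y = x * extendLeft φ m y
    refine (denseRange_actLinear φ hφ).induction_on y
      (isClosed_eq (by fun_prop) (by fun_prop)) ?_
    intro w
    rw [extendLeft_apply m hφ]
    induction w using TensorProduct.induction_on with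
    | zero => simp
    | add w w' hw hw' => simp only [map_add, mul_add, hw, hw']
    | tmul b t =>
      have h := congrArg star (map_mul_extendLeft (star m) hφ (star b) (star x))
      rw [star_mul, star_mul, star_snd, star_star x, star_star b] at h
      simp only [← map_star φ, star_star] at h
      rw [actLinear_tmul, actMulLinear_tmul, ← mul_assoc, ← mul_assoc, h]

theorem extend_fst_map (hφ : Nondegenerate φ) (m : 𝓜(ℂ, A)) (a : A) :
    (extend hφ m).fst (φ a) = φ (m.fst a) :=
  eq_of_mul_left fun x => by
    rw [← fst_mul]
    exact extendLeft_apply m hφ (a ⊗ₜ x)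

theorem eq_extend (hφ : Nondegenerate φ) (m : 𝓜(ℂ, A)) (v : 𝓜(ℂ, T))
    (hv : ∀ a, v.fst (φ a) = φ (m.fst a)) : v = extend hφ m := by
  refine ext_fst fun z => ?_
  refine (denseRange_actLinear φ hφ).induction_on z (isClosed_eq (by fun_prop) (by fun_prop)) ?_
  intro w
  induction w using TensorProduct.induction_on with
  | zero => simp
  | add w w' hw hw' => simp only [map_add, hw, hw']
  | tmul b t => rw [actLinear_tmul, fst_mul, fst_mul, hv, extend_fst_map]

end Extend

section Tensor

variable {A B : Type u} [NonUnitalCStarAlgebra A] [NonUnitalCStarAlgebra B]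

theorem star_fst_mul_fst (u : unitary 𝓜(ℂ, A)) (a b : A) :
    star ((u : 𝓜(ℂ, A)).fst a) * (u : 𝓜(ℂ, A)).fst b = star a * b := by
  have h : star ((u : 𝓜(ℂ, A)).fst a) = (star (u : 𝓜(ℂ, A))).snd (star a) := by
    rw [star_snd, star_star]
  rw [h, central, ← mul_apply_eq_comp, ← mul_fst, Unitary.coe_star_mul_self]
  rfl

theorem snd_mul_star_snd (u : unitary 𝓜(ℂ, A)) (a b : A) :
    (u : 𝓜(ℂ, A)).snd a * star ((u : 𝓜(ℂ, A)).snd b) = a * star b := by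
  have h : star ((u : 𝓜(ℂ, A)).snd b) = (star (u : 𝓜(ℂ, A))).fst (star b) := by
    rw [star_fst, star_star]
  rw [h, central, ← mul_apply_eq_comp, ← mul_fst, Unitary.mul_star_self_of_mem u.2]
  rfl

/-- `a ⊗ b ↦ (u a) ⊗ (v b)` on the algebraic tensor product. -/
def tensorFst (u : unitary 𝓜(ℂ, A)) (v : unitary 𝓜(ℂ, B)) : A ⊗[ℂ] B →ₗ[ℂ] A ⊗[ℂ] B :=
  TensorProduct.map (u : 𝓜(ℂ, A)).fst.toLinearMap (v : 𝓜(ℂ, B)).fst.toLinearMap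

/-- `a ⊗ b ↦ (a u) ⊗ (b v)` on the algebraic tensor product. -/
def tensorSnd (u : unitary 𝓜(ℂ, A)) (v : unitary 𝓜(ℂ, B)) : A ⊗[ℂ] B →ₗ[ℂ] A ⊗[ℂ] B :=
  TensorProduct.map (u : 𝓜(ℂ, A)).snd.toLinearMap (v : 𝓜(ℂ, B)).snd.toLinearMap

theorem tensorFst_tmul (u : unitary 𝓜(ℂ, A)) (v : unitary 𝓜(ℂ, B)) (a : A) (b : B) :
    tensorFst u v (a ⊗ₜ b) = (u : 𝓜(ℂ, A)).fst a ⊗ₜ (v : 𝓜(ℂ, B)).fst b := rfl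

theorem tensorSnd_tmul (u : unitary 𝓜(ℂ, A)) (v : unitary 𝓜(ℂ, B)) (a : A) (b : B) :
    tensorSnd u v (a ⊗ₜ b) = (u : 𝓜(ℂ, A)).snd a ⊗ₜ (v : 𝓜(ℂ, B)).snd b := rfl

theorem star_tensorFst_mul (u : unitary 𝓜(ℂ, A)) (v : unitary 𝓜(ℂ, B)) (x y : A ⊗[ℂ] B) :
    star (tensorFst u v x) * tensorFst u v y = star x * y := by
  induction x using TensorProduct.induction_on with
  | zero => simp
  | add x x' hx hx' => simp only [map_add, star_add, add_mul, hx, hx']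
  | tmul a b =>
    induction y using TensorProduct.induction_on with
    | zero => simp
    | add y y' hy hy' => simp only [map_add, mul_add, hy, hy']
    | tmul c d =>
      simp only [tensorFst_tmul, TensorProduct.star_tmul, Algebra.TensorProduct.tmul_mul_tmul,
        star_fst_mul_fst]

theorem tensorSnd_mul_star (u : unitary 𝓜(ℂ, A)) (v : unitary 𝓜(ℂ, B)) (x y : A ⊗[ℂ] B) :
    tensorSnd u v x * star (tensorSnd u v y) = x * star y := by
  induction x using TensorProduct.induction_on with
  | zero => simp
  | add x x' hx hx' => simp only [map_add, add_mul, hx, hx']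
  | tmul a b =>
    induction y using TensorProduct.induction_on with
    | zero => simp
    | add y y' hy hy' => simp only [map_add, star_add, mul_add, hy, hy']
    | tmul c d =>
      simp only [tensorSnd_tmul, TensorProduct.star_tmul, Algebra.TensorProduct.tmul_mul_tmul,
        snd_mul_star_snd]

theorem tensorSnd_mul (u : unitary 𝓜(ℂ, A)) (v : unitary 𝓜(ℂ, B)) (x y : A ⊗[ℂ] B) :
    tensorSnd u v x * y = x * tensorFst u v y := by
  induction x using TensorProduct.induction_on with
  | zero => simp
  | add x x' hx hx' => simp only [map_add, add_mul, hx, hx']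
  | tmul a b =>
    induction y using TensorProduct.induction_on with
    | zero => simp
    | add y y' hy hy' => simp only [map_add, mul_add, hy, hy']
    | tmul c d =>
      simp only [tensorSnd_tmul, tensorFst_tmul, Algebra.TensorProduct.tmul_mul_tmul, central]

theorem minSeminorm_tensorFst (u : unitary 𝓜(ℂ, A)) (v : unitary 𝓜(ℂ, B)) (x : A ⊗[ℂ] B) :
    minSeminorm A B (tensorFst u v x) = minSeminorm A B x := by
  refine (sq_eq_sq₀ (apply_nonneg _ _) (apply_nonneg _ _)).1 ?_
  rw [← CStarSeminorm.star_mul_self, ← CStarSeminorm.star_mul_self, star_tensorFst_mul]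

theorem minSeminorm_tensorSnd (u : unitary 𝓜(ℂ, A)) (v : unitary 𝓜(ℂ, B)) (x : A ⊗[ℂ] B) :
    minSeminorm A B (tensorSnd u v x) = minSeminorm A B x := by
  refine (sq_eq_sq₀ (apply_nonneg _ _) (apply_nonneg _ _)).1 ?_
  rw [← CStarSeminorm.mul_star_self, ← CStarSeminorm.mul_star_self, tensorSnd_mul_star]

/-- The canonical map of the algebraic to the spatial tensor product, as a linear map. -/
def ofLin : A ⊗[ℂ] B →ₗ[ℂ] SpatialTensor A B :=
  (SpatialTensor.ofAlg : A ⊗[ℂ] B →⋆ₙₐ[ℂ] SpatialTensor A B)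

theorem tensor_extend_of {f : A ⊗[ℂ] B →ₗ[ℂ] A ⊗[ℂ] B}
    (hf : ∀ x, minSeminorm A B (f x) = minSeminorm A B x) (x : A ⊗[ℂ] B) :
    (ofLin.comp f).extendOfNorm ofLin (SpatialTensor.ofAlg x) = SpatialTensor.ofAlg (f x) :=
  LinearMap.extendOfNorm_eq (f := ofLin.comp f) (e := ofLin) SpatialTensor.denseRange_ofAlg
    ⟨1, fun x => by
      rw [one_mul]
      exact ((SpatialTensor.norm_ofAlg _).trans
        ((hf x).trans (SpatialTensor.norm_ofAlg x).symm)).le⟩ x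

/-- The multiplier `u ⊗ v` of the spatial tensor product, for unitary multipliers `u` and `v`:
`(u ⊗ v)(a ⊗ b) = u a ⊗ v b` and `(a ⊗ b)(u ⊗ v) = a u ⊗ b v`. -/
def tensor (u : unitary 𝓜(ℂ, A)) (v : unitary 𝓜(ℂ, B)) : 𝓜(ℂ, SpatialTensor A B) where
  fst := (ofLin.comp (tensorFst u v)).extendOfNorm ofLin
  snd := (ofLin.comp (tensorSnd u v)).extendOfNorm ofLin
  central x y := by
    refine SpatialTensor.denseRange_ofAlg.induction_on₂ (p := fun x y =>
      (ofLin.comp (tensorSnd u v)).extendOfNorm ofLin x * y =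
        x * (ofLin.comp (tensorFst u v)).extendOfNorm ofLin y)
      (isClosed_eq (by fun_prop) (by fun_prop)) (fun x y => ?_) x y
    rw [tensor_extend_of (minSeminorm_tensorFst u v), tensor_extend_of (minSeminorm_tensorSnd u v),
      ← map_mul, ← map_mul, tensorSnd_mul]

theorem tensor_fst_tmul (u : unitary 𝓜(ℂ, A)) (v : unitary 𝓜(ℂ, B)) (a : A) (b : B) :
    (tensor u v).fst (SpatialTensor.tmul a b) =
      SpatialTensor.tmul ((u : 𝓜(ℂ, A)).fst a) ((v : 𝓜(ℂ, B)).fst b) :=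
  tensor_extend_of (minSeminorm_tensorFst u v) (a ⊗ₜ b)

theorem tensor_snd_tmul (u : unitary 𝓜(ℂ, A)) (v : unitary 𝓜(ℂ, B)) (a : A) (b : B) :
    (tensor u v).snd (SpatialTensor.tmul a b) =
      SpatialTensor.tmul ((u : 𝓜(ℂ, A)).snd a) ((v : 𝓜(ℂ, B)).snd b) :=
  tensor_extend_of (minSeminorm_tensorSnd u v) (a ⊗ₜ b)

end Tensor

end DoubleCentralizer

namespace GroupCStar

variable {G : Type u} [Group G]

/-- The group element `s`, as a unitary multiplier of `C*(G)`. -/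
def unitaryOf (s : G) : unitary 𝓜(ℂ, GroupCStar G) :=
  ⟨DoubleCentralizer.coe ℂ (of s), DoubleCentralizer.coe_mem_unitary _
    (fun x => by rw [star_of, ← mul_assoc, of_mul_of, inv_mul_cancel, of_one_mul])
    (fun x => by rw [star_of, ← mul_assoc, of_mul_of, mul_inv_cancel, of_one_mul])⟩

end GroupCStar

/-! ## Coactions of discrete groups -/

open SpatialTensor in
/-- The comultiplication `δ_G : C*(G) → C*(G) ⊗ C*(G)`, `δ_G(s) = s ⊗ s`. -/
def GroupCStar.comul (G : Type u) [Group G] :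
    GroupCStar G →⋆ₙₐ[ℂ] SpatialTensor (GroupCStar G) (GroupCStar G) :=
  GroupCStar.lift
    { toFun := fun s => tmul (GroupCStar.of s) (GroupCStar.of s)
      map_mul' := fun s t => by rw [tmul_mul_tmul, GroupCStar.of_mul_of] }
    (fun s => by
      change tmul (GroupCStar.of s⁻¹) (GroupCStar.of s⁻¹) = _
      rw [← GroupCStar.star_of, ← star_tmul]; rfl)

theorem GroupCStar.comul_of {G : Type u} [Group G] (s : G) :
    GroupCStar.comul G (GroupCStar.of s) =
      SpatialTensor.tmul (GroupCStar.of s) (GroupCStar.of s) :=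
  GroupCStar.lift_of _ _ s

/-- A coaction of the discrete group `G` on the `C*`-algebra `A`: an injective nondegenerate
`*`-homomorphism `δ : A → A ⊗ C*(G)` with `(δ ⊗ id) ∘ δ = (id ⊗ δ_G) ∘ δ`. -/
structure Coaction (G A : Type u) [Group G] [NonUnitalCStarAlgebra A] where
  toHom : A →⋆ₙₐ[ℂ] SpatialTensor A (GroupCStar G)
  injective : Function.Injective toHom
  nondegenerate : DoubleCentralizer.Nondegenerate toHom
  coassoc : ∀ a, SpatialTensor.AssocEq
    (SpatialTensor.map toHom (NonUnitalStarAlgHom.id ℂ (GroupCStar G)) (toHom a))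
    (SpatialTensor.map (NonUnitalStarAlgHom.id ℂ A) (GroupCStar.comul G) (toHom a))

namespace Coaction

variable {G A : Type u} [Group G] [NonUnitalCStarAlgebra A] (δ : Coaction G A)

theorem continuous_toHom : Continuous δ.toHom :=
  AddMonoidHomClass.continuous_of_bound δ.toHom 1 fun a => by
    rw [one_mul]; exact NonUnitalStarAlgHom.norm_apply_le δ.toHom a

/-- The elementary tensor `a ⊗ s`, as a continuous linear function of `a`. -/
def tmulOf (s : G) : A →L[ℂ] SpatialTensor A (GroupCStar G) :=
  (DoubleCentralizer.ofLin.comp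
    ((TensorProduct.mk ℂ A (GroupCStar G)).flip (GroupCStar.of s))).mkContinuous
      ‖GroupCStar.of s‖ fun a => by
    rw [mul_comm]
    exact SpatialTensor.norm_tmul_le a (GroupCStar.of s)

theorem tmulOf_apply (s : G) (a : A) :
    tmulOf s a = SpatialTensor.tmul a (GroupCStar.of s) := rfl

/-- The spectral subspace `A_s = {a | δ(a) = a ⊗ s}`. -/
def spectralSubspace (s : G) : Submodule ℂ A :=
  LinearMap.eqLocus (δ.toHom : A →ₗ[ℂ] SpatialTensor A (GroupCStar G)) (tmulOf s).toLinearMap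

theorem mem_spectralSubspace {s : G} {a : A} :
    a ∈ δ.spectralSubspace s ↔ δ.toHom a = SpatialTensor.tmul a (GroupCStar.of s) := Iff.rfl

theorem isClosed_spectralSubspace (s : G) : IsClosed (δ.spectralSubspace s : Set A) :=
  isClosed_eq δ.continuous_toHom (tmulOf s).continuous

instance (s : G) : CompleteSpace (δ.spectralSubspace s) :=
  (δ.isClosed_spectralSubspace s).completeSpace_coe

theorem mul_mem {s t : G} {a b : A} (ha : a ∈ δ.spectralSubspace s)
    (hb : b ∈ δ.spectralSubspace t) : a * b ∈ δ.spectralSubspace (s * t) := by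
  rw [mem_spectralSubspace] at *
  rw [map_mul, ha, hb, SpatialTensor.tmul_mul_tmul, GroupCStar.of_mul_of]

theorem star_mem {s : G} {a : A} (ha : a ∈ δ.spectralSubspace s) :
    star a ∈ δ.spectralSubspace s⁻¹ := by
  rw [mem_spectralSubspace] at *
  rw [map_star, ha, SpatialTensor.star_tmul, GroupCStar.star_of]

/-- The spectral subspace `A_1`, as a `*`-subalgebra. -/
def unitFiber : NonUnitalStarSubalgebra ℂ A where
  toSubmodule := δ.spectralSubspace 1
  mul_mem' ha hb := by simpa using δ.mul_mem ha hb
  star_mem' ha := by simpa using δ.star_mem ha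

theorem exists_star_mul_self_eq {s : G} {a : A} (ha : a ∈ δ.spectralSubspace s) :
    ∃ b ∈ δ.spectralSubspace 1, star a * a = star b * b := by
  let _ := CStarAlgebra.spectralOrder A
  have _ := CStarAlgebra.spectralOrderedRing A
  have h0 : 0 ≤ star a * a := star_mul_self_nonneg a
  have hm : star a * a ∈ δ.unitFiber := by
    have h := δ.mul_mem (δ.star_mem ha) ha
    rwa [inv_mul_cancel] at h
  refine ⟨CFC.sqrt (star a * a), ?_, ?_⟩
  · rw [CFC.sqrt_eq_real_sqrt (star a * a) h0]
    have : IsClosed (δ.unitFiber : Set A) := δ.isClosed_spectralSubspace 1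
    exact cfcₙ_mem (s := δ.unitFiber) Real.sqrt hm
  · rw [(CFC.sqrt_nonneg (star a * a)).isSelfAdjoint.star_eq, CFC.sqrt_mul_sqrt_self _ h0]

theorem sigma_ext {s t : G} (h : s = t) {a : δ.spectralSubspace s} {b : δ.spectralSubspace t}
    (hab : (a : A) = b) : (⟨s, a⟩ : Σ s, δ.spectralSubspace s) = ⟨t, b⟩ := by
  subst h
  rw [Subtype.ext hab]

/-- The Fell bundle associated to a coaction: its fibers are the spectral subspaces, with the
operations of `A`. -/
def fellBundle : FellBundle.{u, u} G where
  fiber s := δ.spectralSubspace s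
  mul {s t} := LinearMap.mk₂ ℂ (fun a b => ⟨(a : A) * b, δ.mul_mem a.2 b.2⟩)
    (fun _ _ _ => Subtype.ext (add_mul _ _ _)) (fun _ _ _ => Subtype.ext (smul_mul_assoc _ _ _))
    (fun _ _ _ => Subtype.ext (mul_add _ _ _)) (fun _ _ _ => Subtype.ext (mul_smul_comm _ _ _))
  star {s} :=
    { toFun := fun a => ⟨Star.star (a : A), δ.star_mem a.2⟩
      map_add' := fun _ _ => Subtype.ext (star_add _ _)
      map_smul' := fun _ _ => Subtype.ext (star_smul _ _) }
  norm_mul_le a b := norm_mul_le (a : A) b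
  norm_star a := norm_star (a : A)
  mul_assoc a b c := δ.sigma_ext (_root_.mul_assoc _ _ _) (_root_.mul_assoc (a : A) b c)
  star_mul a b := δ.sigma_ext (mul_inv_rev _ _) (StarMul.star_mul (a : A) b)
  star_star a := δ.sigma_ext (inv_inv _) (_root_.star_star (a : A))
  norm_star_mul_self a := (CStarRing.norm_star_mul_self (x := (a : A))).trans (sq _).symm
  star_mul_self_nonneg a := by
    obtain ⟨b, hb, h⟩ := δ.exists_star_mul_self_eq a.2
    exact ⟨⟨b, hb⟩, δ.sigma_ext (by simp) h⟩

/-- The coaction is weakly induced from `G ⧸ N`: the associated Fell bundle is isomorphic to the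
pull-back of a Fell bundle over `G ⧸ N`. -/
def IsWeaklyInduced (N : Subgroup G) [N.Normal] : Prop :=
  ∃ 𝒟 : FellBundle.{u, u} (G ⧸ N), Nonempty (δ.fellBundle.Iso (FellBundle.pullback N 𝒟))

/-- The canonical extension of `δ` to the multiplier algebras. -/
def extend (m : 𝓜(ℂ, A)) : 𝓜(ℂ, SpatialTensor A (GroupCStar G)) :=
  DoubleCentralizer.extend δ.nondegenerate m

end Coaction

end

/-!
Let `u : N → UM(𝒜)` be a homomorphism with `u_n` of order `n` and `a u_n = u_{sns⁻¹} a` for `a`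
over `s`. It identifies the fibers of a Fell bundle `𝒜` over the same coset: `a ↦ a u_{s⁻¹t}` is an
isometry from the fiber over `s` to the fiber over `t`. By the commutation relation these
translations are compatible with products and adjoints (`PullbackBundle.Related.mul`,
`PullbackBundle.Related.star`), so the fibers over representatives of the cosets form a Fell bundle
over `G ⧸ N` (`PullbackBundle.descent`) whose pull-back is `𝒜`. Conversely, a pull-back has the
multipliers `(d, s) ↦ (d, ns)` and `(d, s) ↦ (d, sn)` (`PullbackBundle.moveUnitary`).

For the statement on coactions it remains to see that the commuting homomorphisms to `UM(A)` and
those to the unitary multipliers of the associated Fell bundle correspond to each other. A unitary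
`u n` of `A` with `δ(u n) = u n ⊗ n` permutes the spectral subspaces and so restricts to the
bundle. In the other direction, a unitary multiplier `m` of the bundle is extended to `A` by `m (b
y) = (m b) y` for `b` spectral and `y` in `A`. This is isometric on linear combinations because `(m
b)* (m c) = b* c`, and it determines a multiplier of `A` because the products `b y` span a dense
subspace (`Coaction.spectralMul_dense`).

That density rests on the slice maps `id ⊗ χ_s : A ⊗ C*(G) → A`, where `χ_s` is the coefficient of
the regular representation with `χ_s(t) = 1` for `t = s` and `χ_s(t) = 0` otherwise. They are
bounded because the representations `(π ⊗ ρ) ∘ δ` determine the norm of `A`, the map `δ` being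
injective, and by the coaction identity `(id ⊗ χ_s) ∘ δ` takes values in the spectral subspace of
`s` (`Coaction.component_mem`). Applying `id ⊗ χ_1` to an approximation `x ⊗ 1 ≈ ∑ δ(a) (y ⊗ t)`,
which nondegeneracy of `δ` provides, gives `x ≈ ∑ b y` with `b = (id ⊗ χ_{t⁻¹})(δ(a))`.
-/

noncomputable section

/-! ### Homomorphisms to unitary groups -/

/-- A homomorphism `v` from a group to a monoid with involution such that `v n⁻¹ = (v n)*` takes
unitary values. -/
def MonoidHom.toUnitary {H M : Type*} [Group H] [Monoid M] [StarMul M] (v : H →* M)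
    (hv : ∀ n, star (v n) = v n⁻¹) : H →* unitary M where
  toFun n := ⟨v n, by
    rw [Unitary.mem_iff, hv, ← map_mul, ← map_mul, inv_mul_cancel, mul_inv_cancel, map_one]
    exact ⟨rfl, rfl⟩⟩
  map_one' := Subtype.ext (map_one v)
  map_mul' m n := Subtype.ext (map_mul v m n)

theorem unitary.coe_map_inv {H M : Type*} [Group H] [Monoid M] [StarMul M] (w : H →* unitary M)
    (n : H) : (w n⁻¹ : M) = star (w n : M) := by
  rw [map_inv]; rfl

namespace PullbackBundle

variable {G : Type u} [Group G] {𝒜 : FellBundle.{u, v} G}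

/-! ### Elements and multipliers of a Fell bundle -/

section Total

/-- The element of the total space given by an element of a fiber. -/
def mk (s : G) (a : 𝒜.fiber s) : 𝒜.Total := ⟨s, a⟩

theorem mk_fst_snd (a : 𝒜.Total) : mk a.1 a.2 = a := rfl

theorem mk_injective {s : G} {a b : 𝒜.fiber s} (h : mk s a = mk s b) : a = b :=
  eq_of_heq (Sigma.ext_iff.1 h).2

theorem fst_mul (a b : 𝒜.Total) : (a * b).1 = a.1 * b.1 := rfl

theorem fst_star (a : 𝒜.Total) : (star a).1 = a.1⁻¹ := rfl

theorem mk_mul_mk {s t : G} (a : 𝒜.fiber s) (b : 𝒜.fiber t) :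
    mk s a * mk t b = mk (s * t) (𝒜.mul a b) := rfl

theorem star_mk {s : G} (a : 𝒜.fiber s) : star (mk s a) = mk s⁻¹ (𝒜.star a) := rfl

/-- The norm of an element of the total space. -/
def totalNorm (a : 𝒜.Total) : ℝ := ‖a.2‖

theorem totalNorm_mk {s : G} (a : 𝒜.fiber s) : totalNorm (mk s a) = ‖a‖ := rfl

theorem totalNorm_nonneg (a : 𝒜.Total) : 0 ≤ totalNorm a := norm_nonneg _

theorem totalNorm_star (a : 𝒜.Total) : totalNorm (star a) = totalNorm a := 𝒜.norm_star a.2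

theorem totalNorm_star_mul_self (a : 𝒜.Total) : totalNorm (star a * a) = totalNorm a ^ 2 :=
  𝒜.norm_star_mul_self a.2

theorem totalNorm_mul_star_self (a : 𝒜.Total) : totalNorm (a * star a) = totalNorm a ^ 2 := by
  simpa [totalNorm_star] using totalNorm_star_mul_self (star a)

/-- The identity between fibers over equal group elements. -/
def castFiber {s t : G} (h : s = t) : 𝒜.fiber s →ₗ[ℂ] 𝒜.fiber t := h ▸ LinearMap.id

theorem mk_castFiber {s t : G} (h : s = t) (a : 𝒜.fiber s) : mk t (castFiber h a) = mk s a := by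
  subst h; rfl

theorem mk_left_cancel {s : G} {x y : 𝒜.fiber s} (h : ∀ c : 𝒜.Total, mk s x * c = mk s y * c) :
    x = y := by
  have h0 : 𝒜.mul (x - y) (𝒜.star (x - y)) = 0 := by
    rw [map_sub, LinearMap.sub_apply, sub_eq_zero]
    exact mk_injective (h (mk _ (𝒜.star (x - y))))
  have h1 := totalNorm_mul_star_self (mk s (x - y))
  rw [star_mk, mk_mul_mk, totalNorm_mk, totalNorm_mk, h0, norm_zero] at h1
  exact sub_eq_zero.1 (norm_eq_zero.1 (pow_eq_zero_iff two_ne_zero |>.1 h1.symm))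

/-- An element of a Fell bundle is determined by its fiber and its products with all elements. -/
theorem eq_of_mul_right {x y : 𝒜.Total} (hf : x.1 = y.1) (h : ∀ c, x * c = y * c) : x = y := by
  obtain ⟨s, x⟩ := x
  obtain ⟨t, y⟩ := y
  obtain rfl : s = t := hf
  exact congrArg (mk s) (mk_left_cancel h)

end Total

namespace Multiplier

theorem right_mul_fst_eq (m : 𝒜.Multiplier) (a b : 𝒜.Total) :
    (m.right (a * b)).1 = (a * m.right b).1 := by
  obtain ⟨s, -, hs⟩ := m.exists_order
  rw [hs, fst_mul, fst_mul, hs, mul_assoc]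

theorem right_mul (m : 𝒜.Multiplier) (a b : 𝒜.Total) : m.right (a * b) = a * m.right b :=
  eq_of_mul_right (right_mul_fst_eq m a b) fun c => by
    rw [m.assoc, mul_assoc, mul_assoc, m.assoc]

theorem mul_left (m m' : 𝒜.Multiplier) (a : 𝒜.Total) : (m * m').left a = m.left (m'.left a) := rfl

theorem mul_right (m m' : 𝒜.Multiplier) (a : 𝒜.Total) : (m * m').right a = m'.right (m.right a) :=
  rfl

theorem one_left (a : 𝒜.Total) : (1 : 𝒜.Multiplier).left a = a := rfl

theorem star_left (m : 𝒜.Multiplier) (a : 𝒜.Total) :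
    (star m).left a = star (m.right (star a)) := rfl

theorem star_right (m : 𝒜.Multiplier) (a : 𝒜.Total) :
    (star m).right a = star (m.left (star a)) := rfl

theorem unitary_right_mul_star (m : unitary 𝒜.Multiplier) (a b : 𝒜.Total) :
    (m : 𝒜.Multiplier).right a * star ((m : 𝒜.Multiplier).right b) = a * star b := by
  have h : star ((m : 𝒜.Multiplier).right b) = (star (m : 𝒜.Multiplier)).left (star b) := by
    rw [star_left, star_star]
  rw [h, FellBundle.Multiplier.assoc, ← mul_left, Unitary.mul_star_self_of_mem m.2, one_left]

theorem star_unitary_left_mul (m : unitary 𝒜.Multiplier) (a b : 𝒜.Total) :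
    star ((m : 𝒜.Multiplier).left a) * (m : 𝒜.Multiplier).left b = star a * b := by
  have h : star ((m : 𝒜.Multiplier).left a) = (star (m : 𝒜.Multiplier)).right (star a) := by
    rw [star_right, star_star]
  rw [h, FellBundle.Multiplier.assoc, ← mul_left, Unitary.star_mul_self_of_mem m.2, one_left]

theorem totalNorm_unitary_right (m : unitary 𝒜.Multiplier) (a : 𝒜.Total) :
    totalNorm ((m : 𝒜.Multiplier).right a) = totalNorm a := by
  rw [← sq_eq_sq₀ (totalNorm_nonneg _) (totalNorm_nonneg _), ← totalNorm_mul_star_self,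
    unitary_right_mul_star, totalNorm_mul_star_self]

/-- Right multiplication by a multiplier, as a map from one fiber to another. It is linear because
`(a m) b = a (m b)` for all `b`, and `a m` is determined by these products. -/
def rightFiber (m : 𝒜.Multiplier) {s t : G} (h : ∀ a : 𝒜.fiber s, (m.right (mk s a)).1 = t) :
    𝒜.fiber s →ₗ[ℂ] 𝒜.fiber t :=
  have key : ∀ (f : 𝒜.fiber s → 𝒜.fiber t) (_ : ∀ a, mk t (f a) = m.right (mk s a)),
      (∀ a b, f (a + b) = f a + f b) ∧ ∀ (c : ℂ) a, f (c • a) = c • f a := by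
    intro f hf
    obtain ⟨r, hl, hr⟩ := m.exists_order
    have hst : ∀ c : 𝒜.Total, ∀ a : 𝒜.fiber s, s * (m.left c).1 = t * c.1 := fun c a => by
      rw [← h a, hr, hl, mul_assoc]; rfl
    have hm : ∀ a (c : 𝒜.Total),
        𝒜.mul (f a) c.2 = castFiber (hst c a) (𝒜.mul a (m.left c).2) := fun a c => by
      apply mk_injective
      rw [mk_castFiber, ← mk_mul_mk, ← mk_mul_mk, hf, mk_fst_snd, mk_fst_snd, m.assoc]
    refine ⟨fun a b => mk_left_cancel fun c => ?_, fun z a => mk_left_cancel fun c => ?_⟩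
    · rw [← mk_fst_snd c, mk_mul_mk, mk_mul_mk, hm, map_add 𝒜.mul (f a), LinearMap.add_apply, hm,
        hm, map_add 𝒜.mul a, LinearMap.add_apply, map_add]
    · rw [← mk_fst_snd c, mk_mul_mk, mk_mul_mk, hm, map_smul 𝒜.mul z (f a), LinearMap.smul_apply,
        hm, map_smul 𝒜.mul z a, LinearMap.smul_apply, map_smul]
  have hf : ∀ a, mk t (h a ▸ (m.right (mk s a)).2) = m.right (mk s a) := fun a =>
    Sigma.ext (h a).symm (eqRec_heq _ _)
  { toFun := fun a => h a ▸ (m.right (mk s a)).2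
    map_add' := (key _ hf).1
    map_smul' := (key _ hf).2 }

theorem mk_rightFiber (m : 𝒜.Multiplier) {s t : G}
    (h : ∀ a : 𝒜.fiber s, (m.right (mk s a)).1 = t) (a : 𝒜.fiber s) :
    mk t (rightFiber m h a) = m.right (mk s a) :=
  Sigma.ext (h a).symm (eqRec_heq _ _)

end Multiplier

/-! ### Descent of a Fell bundle along commuting unitary multipliers -/

variable {N : Subgroup G}

section Related

variable {u : N →* unitary 𝒜.Multiplier}

/-- `b` is a right translate `a u_n` of `a`. -/
def Related (u : N →* unitary 𝒜.Multiplier) (a b : 𝒜.Total) : Prop :=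
  ∃ n : N, b = (u n : 𝒜.Multiplier).right a

theorem Related.refl (u : N →* unitary 𝒜.Multiplier) (a : 𝒜.Total) : Related u a a :=
  ⟨1, by rw [map_one]; rfl⟩

theorem Related.symm {a b : 𝒜.Total} (h : Related u a b) : Related u b a := by
  obtain ⟨n, rfl⟩ := h
  refine ⟨n⁻¹, ?_⟩
  rw [← Multiplier.mul_right, ← Submonoid.coe_mul, ← map_mul, mul_inv_cancel, map_one]
  rfl

theorem Related.trans {a b c : 𝒜.Total} (h : Related u a b) (h' : Related u b c) :
    Related u a c := by
  obtain ⟨n, rfl⟩ := h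
  obtain ⟨m, rfl⟩ := h'
  exact ⟨n * m, by rw [map_mul, Submonoid.coe_mul, Multiplier.mul_right]⟩

theorem Related.totalNorm_eq {a b : 𝒜.Total} (h : Related u a b) : totalNorm b = totalNorm a := by
  obtain ⟨n, rfl⟩ := h
  exact Multiplier.totalNorm_unitary_right _ _

end Related

variable [N.Normal]

/-- The condition on `u : N → UM(𝒜)` that characterizes pull-back bundles: `u n` has order `n`, and
`a u_n = u_{s n s⁻¹} a` for `a` in the fiber over `s`. -/
structure IsCommuting (u : N →* unitary 𝒜.Multiplier) : Prop where
  order : ∀ n : N, (u n : 𝒜.Multiplier) ∈ 𝒜.multipliersOfOrder (n : G)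
  comm : ∀ (a : 𝒜.Total) (n : N), (u n : 𝒜.Multiplier).right a =
    (u ⟨a.1 * n * a.1⁻¹, Subgroup.Normal.conj_mem inferInstance n.1 n.2 a.1⟩ : 𝒜.Multiplier).left a

section Descent

variable {u : N →* unitary 𝒜.Multiplier} (hu : IsCommuting u)

include hu in
theorem related_left (n : N) (a : 𝒜.Total) : Related u a ((u n : 𝒜.Multiplier).left a) := by
  refine ⟨⟨a.1⁻¹ * n * a.1, by
    simpa using Subgroup.Normal.conj_mem inferInstance n.1 n.2 a.1⁻¹⟩, ?_⟩
  rw [hu.comm]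
  congr 4
  ext
  change (n : G) = a.1 * (a.1⁻¹ * n * a.1) * a.1⁻¹
  group

include hu in
/-- Uses `(a u_n) b = a (u_n b)` and that `u_n b` is again a right translate of
`b`. -/
theorem Related.mul {a a' b b' : 𝒜.Total} (h : Related u a a') (h' : Related u b b') :
    Related u (a * b) (a' * b') := by
  obtain ⟨n, rfl⟩ := h
  obtain ⟨m, rfl⟩ := h'
  obtain ⟨k, hk⟩ := related_left hu n b
  refine Related.trans (b := (u n : 𝒜.Multiplier).right a * b) ⟨k, ?_⟩ ⟨m, ?_⟩
  · rw [(u n : 𝒜.Multiplier).assoc, hk, Multiplier.right_mul]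
  · rw [Multiplier.right_mul]

include hu in
theorem Related.star {a b : 𝒜.Total} (h : Related u a b) : Related u (star a) (star b) := by
  obtain ⟨n, rfl⟩ := h
  have h := related_left hu n⁻¹ (Star.star a)
  rwa [unitary.coe_map_inv, Multiplier.star_left, star_star] at h

include hu in
/-- Right translation by `u n` with `n ≠ 1` moves an element to a different fiber, so related
elements of the same fiber are equal. -/
theorem Related.eq {a b : 𝒜.Total} (h : Related u a b) (hf : a.1 = b.1) : a = b := by
  obtain ⟨n, rfl⟩ := h
  have h1 : n = 1 := by
    rw [(hu.order n).2, left_eq_mul] at hf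
    exact Subtype.ext hf
  rw [h1, map_one]
  rfl

include hu in
theorem Related.coe_eq {a b : 𝒜.Total} (h : Related u a b) : (a.1 : G ⧸ N) = b.1 := by
  obtain ⟨n, rfl⟩ := h
  rw [(hu.order n).2, QuotientGroup.eq]
  simp

/-- Translation `a ↦ a u_{s⁻¹t}` of the fiber over `s` to the fiber over `t`, for `sN = tN`. -/
def translateHom {s t : G} (h : (s : G ⧸ N) = t) : 𝒜.fiber s →ₗ[ℂ] 𝒜.fiber t :=
  Multiplier.rightFiber (u ⟨s⁻¹ * t, QuotientGroup.eq.1 h⟩ : 𝒜.Multiplier) fun a => by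
    rw [(hu.order _).2]; exact mul_inv_cancel_left s t

theorem related_translateHom {s t : G} (h : (s : G ⧸ N) = t) (a : 𝒜.fiber s) :
    Related u (mk s a) (mk t (translateHom hu h a)) :=
  ⟨_, Multiplier.mk_rightFiber _ _ a⟩

/-- Translation between the fibers over a coset, as an isometry. -/
def translate {s t : G} (h : (s : G ⧸ N) = t) : 𝒜.fiber s ≃ₗᵢ[ℂ] 𝒜.fiber t where
  toLinearEquiv := LinearEquiv.ofLinearMap (translateHom hu h) (translateHom hu h.symm)
    (LinearMap.ext fun a => mk_injective <| Eq.symm <| Related.eq hu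
      ((related_translateHom hu h.symm a).trans (related_translateHom hu h _)) rfl)
    (LinearMap.ext fun a => mk_injective <| Eq.symm <| Related.eq hu
      ((related_translateHom hu h a).trans (related_translateHom hu h.symm _)) rfl)
  norm_map' a := (related_translateHom hu h a).totalNorm_eq

theorem related_translate {s t : G} (h : (s : G ⧸ N) = t) (a : 𝒜.fiber s) :
    Related u (mk s a) (mk t (translate hu h a)) := related_translateHom hu h a

include hu in
/-- An identity in the fiber over a coset, chosen to be the fiber over a representative, may be
verified up to translation. -/
theorem sigma_out_ext {x y : G ⧸ N} {a : 𝒜.fiber x.out} {b : 𝒜.fiber y.out}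
    (h : Related u (mk x.out a) (mk y.out b)) :
    (⟨x, a⟩ : Σ x : G ⧸ N, 𝒜.fiber x.out) = ⟨y, b⟩ := by
  have hxy : x = y := by
    have h1 := h.coe_eq hu
    change (x.out : G ⧸ N) = y.out at h1
    rwa [QuotientGroup.out_eq', QuotientGroup.out_eq'] at h1
  subst hxy
  rw [mk_injective (h.eq hu rfl)]

theorem coe_out_mul (x y : G ⧸ N) : ((x.out * y.out : G) : G ⧸ N) = (x * y).out := by
  rw [QuotientGroup.mk_mul, QuotientGroup.out_eq', QuotientGroup.out_eq', QuotientGroup.out_eq']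

theorem coe_out_inv (x : G ⧸ N) : ((x.out⁻¹ : G) : G ⧸ N) = (x⁻¹).out := by
  rw [QuotientGroup.mk_inv, QuotientGroup.out_eq', QuotientGroup.out_eq']

/-- Multiplication of the descended bundle: multiplication in `𝒜`, translated to the
representative. -/
def descentMul (x y : G ⧸ N) : 𝒜.fiber x.out →ₗ[ℂ] 𝒜.fiber y.out →ₗ[ℂ] 𝒜.fiber (x * y).out :=
  (𝒜.mul (s := x.out) (t := y.out)).compr₂ (translateHom hu (coe_out_mul x y))

theorem related_descentMul {x y : G ⧸ N} (a : 𝒜.fiber x.out) (b : 𝒜.fiber y.out) :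
    Related u (mk x.out a * mk y.out b) (mk _ (descentMul hu x y a b)) :=
  related_translateHom hu (coe_out_mul x y) (𝒜.mul a b)

/-- Involution of the descended bundle. -/
def descentStar (x : G ⧸ N) : 𝒜.fiber x.out →ₗ⋆[ℂ] 𝒜.fiber (x⁻¹).out :=
  (translateHom hu (coe_out_inv x)).comp (𝒜.star (s := x.out))

theorem related_descentStar {x : G ⧸ N} (a : 𝒜.fiber x.out) :
    Related u (star (mk x.out a)) (mk _ (descentStar hu x a)) :=
  related_translateHom hu (coe_out_inv x) (𝒜.star a)

/-- The Fell bundle over `G ⧸ N` whose fiber over a coset is the fiber of `𝒜` over a chosen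
representative; the fibers over the other representatives are identified with it by
translation. -/
def descent : FellBundle.{u, v} (G ⧸ N) where
  fiber x := 𝒜.fiber x.out
  mul {x y} := descentMul hu x y
  star {x} := descentStar hu x
  norm_mul_le a b := (related_descentMul hu a b).totalNorm_eq.trans_le (𝒜.norm_mul_le a b)
  norm_star a := (related_descentStar hu a).totalNorm_eq.trans (𝒜.norm_star a)
  mul_assoc a b c := sigma_out_ext hu <| by
    have h1 := ((related_descentMul hu a b).mul hu (Related.refl u (mk _ c))).trans
      (related_descentMul hu _ c)
    have h2 := ((Related.refl u (mk _ a)).mul hu (related_descentMul hu b c)).trans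
      (related_descentMul hu a _)
    rw [mul_assoc] at h1
    exact h1.symm.trans h2
  star_mul a b := sigma_out_ext hu <| by
    have h1 := ((related_descentMul hu a b).star hu).trans (related_descentStar hu _)
    have h2 := ((related_descentStar hu b).mul hu (related_descentStar hu a)).trans
      (related_descentMul hu _ _)
    rw [star_mul] at h1
    exact h1.symm.trans h2
  star_star a := sigma_out_ext hu <| by
    have h1 := ((related_descentStar hu a).star hu).trans (related_descentStar hu _)
    rw [star_star] at h1
    exact h1.symm
  norm_star_mul_self {x} a := by
    have h1 := ((related_descentStar hu a).mul hu (Related.refl u (mk _ a))).trans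
      (related_descentMul hu _ a)
    exact h1.totalNorm_eq.trans (totalNorm_star_mul_self (mk _ a))
  star_mul_self_nonneg {x} a := by
    obtain ⟨b, hb⟩ := 𝒜.star_mul_self_nonneg a
    have hb : star (mk _ a) * mk _ a = star (mk 1 b) * mk 1 b := hb
    have h0 : ((1 : G) : G ⧸ N) = ((1 : G ⧸ N).out : G) := by
      rw [QuotientGroup.out_eq']; rfl
    have h1 := ((related_descentStar hu a).mul hu (Related.refl u (mk _ a))).trans
      (related_descentMul hu _ a)
    have hr := related_translate hu h0 b
    have h2 := ((hr.star hu).trans (related_descentStar hu _)).mul hu hr |>.trans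
      (related_descentMul hu _ _)
    rw [hb] at h1
    exact ⟨translate hu h0 b, sigma_out_ext hu (h1.symm.trans h2)⟩

/-- The bundle `𝒜` is the pull-back of its descent, by translation. -/
def isoDescent : 𝒜.Iso (FellBundle.pullback N (descent hu)) where
  toEquiv s := translate (t := (s : G ⧸ N).out) hu (QuotientGroup.out_eq' _).symm
  map_mul {s t} a b := mk_injective (s := ((s * t : G) : G ⧸ N).out) <| Eq.symm <| by
    have h1 := related_translate hu
      (QuotientGroup.out_eq' ((s * t : G) : G ⧸ N)).symm (𝒜.mul a b)
    have h2 := ((related_translate hu (QuotientGroup.out_eq' (s : G ⧸ N)).symm a).mul hu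
      (related_translate hu (QuotientGroup.out_eq' (t : G ⧸ N)).symm b)).trans
      (related_descentMul hu _ _)
    exact (h2.symm.trans h1).eq hu rfl
  map_star {s} a := mk_injective (s := ((s⁻¹ : G) : G ⧸ N).out) <| Eq.symm <| by
    have h1 := related_translate hu
      (QuotientGroup.out_eq' ((s⁻¹ : G) : G ⧸ N)).symm (𝒜.star a)
    have h2 := ((related_translate hu (QuotientGroup.out_eq' (s : G ⧸ N)).symm a).star hu).trans
      (related_descentStar hu _)
    exact (h2.symm.trans h1).eq hu rfl

end Descent

/-! ### The commuting unitary multipliers of a pull-back -/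

section Pullback

variable {𝒟 : FellBundle.{u, v} (G ⧸ N)} (φ : 𝒜.Iso (FellBundle.pullback N 𝒟))

/-- The projection of a pull-back of `𝒟` to `𝒟`. -/
def proj (a : 𝒜.Total) : 𝒟.Total := ⟨(a.1 : G ⧸ N), φ.toEquiv a.1 a.2⟩

theorem proj_mul (a b : 𝒜.Total) : proj φ (a * b) = proj φ a * proj φ b :=
  congrArg (fun d => (⟨_, d⟩ : 𝒟.Total)) (φ.map_mul a.2 b.2)

theorem proj_star (a : 𝒜.Total) : proj φ (star a) = star (proj φ a) :=
  congrArg (fun d => (⟨_, d⟩ : 𝒟.Total)) (φ.map_star a.2)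

theorem proj_ext {a b : 𝒜.Total} (hf : a.1 = b.1) (h : proj φ a = proj φ b) : a = b := by
  obtain ⟨s, a⟩ := a
  obtain ⟨t, b⟩ := b
  obtain rfl : s = t := hf
  exact congrArg (mk s) ((φ.toEquiv s).injective (eq_of_heq (Sigma.ext_iff.1 h).2))

theorem exists_proj_eq (a : 𝒜.Total) (s : G) (h : (s : G ⧸ N) = a.1) :
    ∃ b : 𝒜.Total, b.1 = s ∧ proj φ b = proj φ a := by
  obtain ⟨d, hd⟩ : ∃ d : 𝒟.fiber (s : G ⧸ N), (⟨_, d⟩ : 𝒟.Total) = proj φ a := by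
    refine ⟨h ▸ (proj φ a).2, Sigma.ext h ?_⟩
    exact eqRec_heq _ _
  refine ⟨mk s ((φ.toEquiv s).symm d), rfl, ?_⟩
  rw [← hd]
  exact congrArg (fun d => (⟨_, d⟩ : 𝒟.Total)) ((φ.toEquiv s).apply_symm_apply d)

/-- The element of the fiber over `s` with the same projection as `a`, where `sN` is the coset over
which `a` lives. -/
def move (a : 𝒜.Total) (s : G) (h : (s : G ⧸ N) = a.1) : 𝒜.Total :=
  (exists_proj_eq φ a s h).choose

theorem move_fst (a : 𝒜.Total) (s : G) (h : (s : G ⧸ N) = a.1) : (move φ a s h).1 = s :=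
  (exists_proj_eq φ a s h).choose_spec.1

theorem proj_move (a : 𝒜.Total) (s : G) (h : (s : G ⧸ N) = a.1) :
    proj φ (move φ a s h) = proj φ a :=
  (exists_proj_eq φ a s h).choose_spec.2

theorem coe_mul_left (n : N) (s : G) : ((n * s : G) : G ⧸ N) = s := by
  rw [QuotientGroup.mk_mul, (QuotientGroup.eq_one_iff (n : G)).2 n.2, one_mul]

theorem coe_mul_right (n : N) (s : G) : ((s * n : G) : G ⧸ N) = s := by
  rw [QuotientGroup.mk_mul, (QuotientGroup.eq_one_iff (n : G)).2 n.2, mul_one]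

/-- The multiplier `(d, s) ↦ (d, ns)`, `(d, s) ↦ (d, sn)` of a pull-back. -/
def moveMultiplier (n : N) : 𝒜.Multiplier where
  left a := move φ a (n * a.1) (coe_mul_left n a.1)
  right a := move φ a (a.1 * n) (coe_mul_right n a.1)
  exists_order := ⟨n, fun _ => move_fst _ _ _ _, fun _ => move_fst _ _ _ _⟩
  assoc a b := proj_ext φ
    (by rw [fst_mul, fst_mul, move_fst, move_fst, mul_assoc])
    (by rw [proj_mul, proj_mul, proj_move, proj_move])

theorem moveMultiplier_left_fst (n : N) (a : 𝒜.Total) :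
    ((moveMultiplier φ n).left a).1 = n * a.1 :=
  move_fst _ _ _ (coe_mul_left n a.1)

theorem moveMultiplier_right_fst (n : N) (a : 𝒜.Total) :
    ((moveMultiplier φ n).right a).1 = a.1 * n :=
  move_fst _ _ _ (coe_mul_right n a.1)

theorem proj_moveMultiplier_left (n : N) (a : 𝒜.Total) :
    proj φ ((moveMultiplier φ n).left a) = proj φ a :=
  proj_move _ _ _ (coe_mul_left n a.1)

theorem proj_moveMultiplier_right (n : N) (a : 𝒜.Total) :
    proj φ ((moveMultiplier φ n).right a) = proj φ a :=
  proj_move _ _ _ (coe_mul_right n a.1)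

/-- The unitary multipliers `(d, s) ↦ (d, ns)` of a pull-back. -/
def moveUnitary : N →* unitary 𝒜.Multiplier :=
  MonoidHom.toUnitary
    { toFun := moveMultiplier φ
      map_one' := by
        ext1 <;> funext a <;> refine proj_ext φ ?_ ?_
        · rw [moveMultiplier_left_fst]; exact one_mul _
        · exact proj_moveMultiplier_left φ 1 a
        · rw [moveMultiplier_right_fst]; exact mul_one _
        · exact proj_moveMultiplier_right φ 1 a
      map_mul' := fun m n => by
        ext1 <;> funext a <;> refine proj_ext φ ?_ ?_
        · rw [Multiplier.mul_left]
          simp only [moveMultiplier_left_fst]; exact mul_assoc _ _ _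
        · rw [Multiplier.mul_left]; simp only [proj_moveMultiplier_left]
        · rw [Multiplier.mul_right]
          simp only [moveMultiplier_right_fst]; exact (mul_assoc _ _ _).symm
        · rw [Multiplier.mul_right]; simp only [proj_moveMultiplier_right] }
    fun n => by
      change star (moveMultiplier φ n) = moveMultiplier φ n⁻¹
      ext1 <;> funext a <;> refine proj_ext φ ?_ ?_
      · rw [Multiplier.star_left]
        simp only [moveMultiplier_left_fst, fst_star, moveMultiplier_right_fst]
        simp
      · rw [Multiplier.star_left]
        simp only [proj_star, proj_moveMultiplier_left, proj_moveMultiplier_right, star_star]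
      · rw [Multiplier.star_right]
        simp only [moveMultiplier_left_fst, fst_star, moveMultiplier_right_fst]
        simp
      · rw [Multiplier.star_right]
        simp only [proj_star, proj_moveMultiplier_left, proj_moveMultiplier_right, star_star]

theorem isCommuting_moveUnitary : IsCommuting (moveUnitary φ) where
  order n := ⟨moveMultiplier_left_fst φ n, moveMultiplier_right_fst φ n⟩
  comm a n := proj_ext φ
    ((moveMultiplier_right_fst φ n a).trans (Eq.symm
      ((moveMultiplier_left_fst φ _ a).trans (inv_mul_cancel_right _ _))))
    ((proj_moveMultiplier_right φ n a).trans (proj_moveMultiplier_left φ _ a).symm)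

end Pullback

/-- A Fell bundle is a pull-back if and only if it has a commuting homomorphism to its unitary
multipliers. -/
theorem exists_iso_pullback_iff (𝒜 : FellBundle.{u, v} G) (N : Subgroup G) [N.Normal] :
    (∃ 𝒟 : FellBundle.{u, v} (G ⧸ N), Nonempty (𝒜.Iso (FellBundle.pullback N 𝒟))) ↔
      ∃ u : N →* unitary 𝒜.Multiplier, IsCommuting u :=
  ⟨fun ⟨_, ⟨φ⟩⟩ => ⟨moveUnitary φ, isCommuting_moveUnitary φ⟩,
    fun ⟨_, hu⟩ => ⟨descent hu, ⟨isoDescent hu⟩⟩⟩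

end PullbackBundle

/-! ### Matrix coefficients on spatial tensor products -/

/-- A `*`-homomorphism between `C*`-algebras, as a continuous linear map. -/
def NonUnitalStarAlgHom.toCLM {A : Type u} {B : Type v} [NonUnitalCStarAlgebra A]
    [NonUnitalCStarAlgebra B] (φ : A →⋆ₙₐ[ℂ] B) : A →L[ℂ] B :=
  LinearMap.mkContinuous (φ : A →ₗ[ℂ] B) 1 fun a => by
    rw [one_mul]; exact NonUnitalStarAlgHom.norm_apply_le φ a

theorem NonUnitalStarAlgHom.toCLM_apply {A : Type u} {B : Type v} [NonUnitalCStarAlgebra A]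
    [NonUnitalCStarAlgebra B] (φ : A →⋆ₙₐ[ℂ] B) (a : A) : φ.toCLM a = φ a := rfl

namespace CStarRep

variable {A B : Type u} [NonUnitalCStarAlgebra A] [NonUnitalCStarAlgebra B]

/-- The matrix coefficient `a ↦ ⟨v, π(a) w⟩`. -/
def coeff (π : CStarRep A) (v w : π.space) : A →L[ℂ] ℂ :=
  (innerSL ℂ v).comp ((ContinuousLinearMap.apply ℂ π.space w).comp π.hom.toCLM)

theorem coeff_apply (π : CStarRep A) (v w : π.space) (a : A) :
    π.coeff v w a = inner ℂ v (π.hom a w) := rfl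

theorem norm_coeff_le (π : CStarRep A) (v w : π.space) (a : A) :
    ‖π.coeff v w a‖ ≤ ‖v‖ * (‖a‖ * ‖w‖) := by
  refine (norm_inner_le_norm _ _).trans ?_
  gcongr
  refine ((π.hom a).le_opNorm w).trans ?_
  gcongr
  exact NonUnitalStarAlgHom.norm_apply_le π.hom a

theorem tensor_hom_ofAlg (π : CStarRep A) (ρ : CStarRep B) (x : A ⊗[ℂ] B) :
    (π.tensor ρ).hom (SpatialTensor.ofAlg x) = π.tensorAlg ρ x :=
  SpatialTensor.lift_ofAlg _ (le_minSeminorm π ρ) x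

open SpatialTensor in
theorem tensor_hom_tmul_vec (π : CStarRep A) (ρ : CStarRep B) (a : A) (b : B) (h : π.space)
    (k : ρ.space) :
    (π.tensor ρ).hom (tmul a b) (vec π ρ h k) = vec π ρ (π.hom a h) (ρ.hom b k) := by
  rw [tmul, tensor_hom_ofAlg, tensorAlg_tmul]
  exact (HilbertTensor.op_incl _ _ _).trans (by rw [TensorProduct.mapL_tmul]; rfl)

open SpatialTensor in
theorem inner_vec (π : CStarRep A) (ρ : CStarRep B) (h h' : π.space) (k k' : ρ.space) :
    inner ℂ (vec π ρ h k) (vec π ρ h' k') = inner ℂ h h' * inner ℂ k k' :=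
  ((HilbertTensor.incl π.space ρ.space).inner_map_map _ _).trans
    (TensorProduct.inner_tmul _ _ _ _ _)

open SpatialTensor in
theorem norm_vec (π : CStarRep A) (ρ : CStarRep B) (h : π.space) (k : ρ.space) :
    ‖vec π ρ h k‖ = ‖h‖ * ‖k‖ :=
  ((HilbertTensor.incl π.space ρ.space).norm_map _).trans (TensorProduct.norm_tmul _ _)

open SpatialTensor in
theorem coeff_tensor_tmul (π : CStarRep A) (ρ : CStarRep B) (h h' : π.space) (k k' : ρ.space)
    (a : A) (b : B) :
    (π.tensor ρ).coeff (vec π ρ h k) (vec π ρ h' k') (tmul a b) =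
      π.coeff h h' a * ρ.coeff k k' b := by
  rw [coeff_apply, tensor_hom_tmul_vec, inner_vec]
  rfl

end CStarRep

namespace SpatialTensor

variable {A B : Type u} [NonUnitalCStarAlgebra A] [NonUnitalCStarAlgebra B]

/-- The norm of the spatial tensor product is the supremum of the norms in the representations
`π ⊗ ρ`. -/
theorem norm_le_of_tensor {z : SpatialTensor A B} {C : ℝ}
    (h : ∀ (π : CStarRep A) (ρ : CStarRep B), ‖(π.tensor ρ).hom z‖ ≤ C) : ‖z‖ ≤ C := by
  refine le_of_forall_pos_le_add fun ε hε => ?_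
  obtain ⟨w, hw⟩ := denseRange_ofAlg.exists_dist_lt z (half_pos hε)
  rw [dist_eq_norm] at hw
  have h1 : ‖ofAlg w‖ ≤ C + ε / 2 := by
    rw [norm_ofAlg]
    refine CStarSeminorm.sup_le ?_
    rintro _ ⟨⟨π, ρ⟩, rfl⟩
    have h2 : ‖(π.tensor ρ).hom (ofAlg w)‖ ≤ C + ε / 2 := by
      have h3 := NonUnitalStarAlgHom.norm_apply_le (π.tensor ρ).hom (z - ofAlg w)
      have h4 := norm_le_norm_add_norm_sub' ((π.tensor ρ).hom (ofAlg w)) ((π.tensor ρ).hom z)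
      rw [norm_sub_rev, ← map_sub] at h4
      linarith [h π ρ]
    rw [CStarRep.tensor_hom_ofAlg] at h2
    exact h2
  have h5 := norm_le_norm_add_norm_sub' z (ofAlg w)
  linarith

theorem eq_of_vec_eq {E : Type*} [NormedAddCommGroup E] [NormedSpace ℂ E] {π : CStarRep A}
    {ρ : CStarRep B} {f g : (π.tensor ρ).space →L[ℂ] E}
    (h : ∀ h k, f (vec π ρ h k) = g (vec π ρ h k)) : f = g := by
  refine DFunLike.coe_injective ((HilbertTensor.denseRange_incl π.space ρ.space).equalizer
    f.continuous g.continuous (funext fun v => ?_))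
  have : f.toLinearMap ∘ₗ (HilbertTensor.incl π.space ρ.space).toLinearMap =
      g.toLinearMap ∘ₗ (HilbertTensor.incl π.space ρ.space).toLinearMap :=
    TensorProduct.ext' h
  exact LinearMap.congr_fun this v

/-- Elements of the spatial tensor product are determined by their matrix coefficients at
elementary tensors. -/
theorem eq_of_coeff {z z' : SpatialTensor A B}
    (h : ∀ (π : CStarRep A) (ρ : CStarRep B) (h h' : π.space) (k k' : ρ.space),
      (π.tensor ρ).coeff (vec π ρ h k) (vec π ρ h' k') z =
        (π.tensor ρ).coeff (vec π ρ h k) (vec π ρ h' k') z') : z = z' := by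
  rw [← sub_eq_zero, ← norm_le_zero_iff]
  refine norm_le_of_tensor fun π ρ => le_of_eq ?_
  rw [map_sub, norm_eq_zero, sub_eq_zero]
  refine eq_of_vec_eq fun h' k' => ?_
  have key : innerSL ℂ ((π.tensor ρ).hom z (vec π ρ h' k')) =
      innerSL ℂ ((π.tensor ρ).hom z' (vec π ρ h' k')) := eq_of_vec_eq fun v w => by
    rw [innerSL_apply_apply, innerSL_apply_apply, ← inner_conj_symm,
      ← inner_conj_symm ((π.tensor ρ).hom z' _)]
    exact congrArg (starRingEnd ℂ) (h π ρ v h' w k')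
  exact ext_inner_right ℂ fun v => congrArg (· v) key

/-- A closed subspace of `A ⊗ C*(G)` that contains all `a ⊗ s` is everything. -/
theorem eq_top_of_tmul_of_mem {G : Type u} [Group G]
    {K : Submodule ℂ (SpatialTensor A (GroupCStar G))}
    (hK : IsClosed (K : Set (SpatialTensor A (GroupCStar G))))
    (h : ∀ a (t : G), tmul a (GroupCStar.of t) ∈ K) : K = ⊤ := by
  have h1 : ∀ a (x : GroupCStar G), tmul a x ∈ K := fun a x => by
    have hc : Continuous fun x : GroupCStar G => tmul a x :=
      AddMonoidHomClass.continuous_of_bound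
        (DoubleCentralizer.ofLin.comp (TensorProduct.mk ℂ A (GroupCStar G) a)) ‖a‖
        fun x => norm_tmul_le a x
    refine GroupCStar.denseRange_ofAlg.induction_on (p := fun x => tmul a x ∈ K) x
      (hK.preimage hc) fun y => ?_
    induction y using MonoidAlgebra.induction_linear with
    | zero =>
      rw [map_zero, tmul, TensorProduct.tmul_zero, map_zero]
      exact K.zero_mem
    | add y y' hy hy' =>
      rw [map_add, tmul, TensorProduct.tmul_add, map_add]
      exact K.add_mem hy hy'
    | single t c =>
      have h3 : MonoidAlgebra.single t c = c • MonoidAlgebra.single t (1 : ℂ) := by simp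
      rw [h3, map_smul, tmul, TensorProduct.tmul_smul, map_smul]
      exact K.smul_mem c (h a t)
  refine (Submodule.eq_top_iff').2 fun z => ?_
  refine denseRange_ofAlg.induction_on (p := fun z => z ∈ K) z hK fun y => ?_
  induction y using TensorProduct.induction_on with
  | zero => rw [map_zero]; exact K.zero_mem
  | add y y' hy hy' => rw [map_add]; exact K.add_mem hy hy'
  | tmul a x => exact h1 a x

/-- Continuous linear maps on `A ⊗ C*(G)` that agree at all `a ⊗ s` are equal. -/
theorem clm_ext {G : Type u} [Group G] {E : Type v} [NormedAddCommGroup E] [NormedSpace ℂ E]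
    {f g : SpatialTensor A (GroupCStar G) →L[ℂ] E}
    (h : ∀ a (t : G), f (tmul a (GroupCStar.of t)) = g (tmul a (GroupCStar.of t))) : f = g := by
  have h1 := eq_top_of_tmul_of_mem (K := LinearMap.eqLocus f.toLinearMap g.toLinearMap)
    (isClosed_eq f.continuous g.continuous) h
  exact ContinuousLinearMap.ext fun z => (Submodule.eq_top_iff'.1 h1 z)

end SpatialTensor

/-! ### The regular representation -/

namespace GroupCStar

variable {G : Type u}

/-- The Hilbert space `ℓ²(G)`. -/
abbrev L2 (G : Type u) : Type u := lp (fun _ : G => ℂ) 2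

/-- The standard basis of `ℓ²(G)`. -/
def basis (G : Type u) : HilbertBasis G ℂ (L2 G) := .ofRepr (.refl ℂ _)

theorem inner_basis [DecidableEq G] (s t : G) :
    inner ℂ (basis G s) (basis G t) = if s = t then 1 else 0 :=
  orthonormal_iff_ite.1 (basis G).orthonormal s t

variable [Group G]

/-- The basis of `ℓ²(G)` translated by `s`. -/
def translatedBasis (s : G) : HilbertBasis G ℂ (L2 G) :=
  HilbertBasis.mk ((basis G).orthonormal.comp (s * ·) (mul_right_injective s)) (by
    rw [(mul_left_surjective s).range_comp, (basis G).dense_span])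

theorem translatedBasis_apply (s t : G) : translatedBasis s t = basis G (s * t) := by
  rw [translatedBasis, HilbertBasis.coe_mk]; rfl

/-- Left translation on `ℓ²(G)`. -/
def shift (s : G) : L2 G ≃ₗᵢ[ℂ] L2 G := (basis G).repr.trans (translatedBasis s).repr.symm

theorem shift_basis (s t : G) : shift s (basis G t) = basis G (s * t) := by
  classical
  rw [shift, LinearIsometryEquiv.trans_apply, HilbertBasis.repr_self,
    HilbertBasis.repr_symm_single, translatedBasis_apply]

theorem shift_mul (s t : G) : shift (s * t) = shift s * shift t := by
  have h : ((shift (s * t) : L2 G ≃ₗᵢ[ℂ] L2 G) : L2 G →L[ℂ] L2 G) =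
      ((shift s * shift t : L2 G ≃ₗᵢ[ℂ] L2 G) : L2 G →L[ℂ] L2 G) := by
    refine ContinuousLinearMap.ext_on
      (Submodule.dense_iff_topologicalClosure_eq_top.2 (basis G).dense_span) ?_
    rintro _ ⟨r, rfl⟩
    change shift (s * t) (basis G r) = shift s (shift t (basis G r))
    rw [shift_basis, shift_basis, shift_basis, mul_assoc]
  exact LinearIsometryEquiv.ext fun v => congrArg (· v) h

/-- The left regular representation of `G`. -/
def regularUnitary : G →* unitary (L2 G →L[ℂ] L2 G) :=
  (Unitary.linearIsometryEquiv (𝕜 := ℂ) (H := L2 G)).symm.toMonoidHom.comp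
    (MonoidHom.mk' shift shift_mul)

theorem regularUnitary_basis (s t : G) :
    (regularUnitary s : L2 G →L[ℂ] L2 G) (basis G t) = basis G (s * t) := shift_basis s t

/-- The left regular representation of `C*(G)`. -/
def regularRep (G : Type u) [Group G] : CStarRep (GroupCStar G) where
  space := L2 G
  hom := lift
    { toFun := fun s => (regularUnitary s : L2 G →L[ℂ] L2 G)
      map_mul' := fun s t => by rw [map_mul]; rfl }
    fun s => unitary.coe_map_inv regularUnitary s

/-- The standard basis vector at `s`, in the space of the regular representation. -/
def vecAt (s : G) : (regularRep G).space := basis G s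

theorem regularRep_of (s t : G) : (regularRep G).hom (of s) (vecAt t) = vecAt (s * t) := by
  rw [← show (regularUnitary s : L2 G →L[ℂ] L2 G) (basis G t) = vecAt (s * t) from
    regularUnitary_basis s t]
  exact congrArg (fun T : L2 G →L[ℂ] L2 G => T (basis G t)) (lift_of _ _ s)

theorem norm_vecAt (s : G) : ‖vecAt s‖ = 1 := (basis G).orthonormal.norm_eq_one s

/-- The matrix coefficient `χ_s` of the regular representation: the continuous linear functional on
`C*(G)` with `χ_s(t) = 1` if `s = t` and `χ_s(t) = 0` otherwise. -/
def chi (s : G) : GroupCStar G →L[ℂ] ℂ := (regularRep G).coeff (vecAt s) (vecAt 1)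

theorem chi_of [DecidableEq G] (s t : G) : chi s (of t) = if s = t then 1 else 0 := by
  rw [chi, CStarRep.coeff_apply, regularRep_of, mul_one]
  exact inner_basis s t

end GroupCStar

/-! ### Spectral subspaces of a coaction -/

namespace Coaction

open SpatialTensor GroupCStar

variable {G A : Type u} [Group G] [NonUnitalCStarAlgebra A] (δ : Coaction G A)

include δ in
/-- The representations `(π ⊗ ρ) ∘ δ` determine the norm of `A`, because `δ` is injective. -/
theorem norm_le_of_rep {a : A} {C : ℝ} (h : ∀ π : CStarRep A, ‖π.hom a‖ ≤ C) : ‖a‖ ≤ C := by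
  rw [← NonUnitalStarAlgHom.norm_map δ.toHom δ.injective a]
  exact norm_le_of_tensor fun π ρ => h ((π.tensor ρ).comp δ.toHom)

/-- The slice map `a ⊗ x ↦ χ_s(x) a` on the algebraic tensor product. -/
def sliceAlg (A : Type u) [NonUnitalCStarAlgebra A] (s : G) : A ⊗[ℂ] GroupCStar G →ₗ[ℂ] A :=
  TensorProduct.lift ((LinearMap.lsmul ℂ A).flip.compl₂ (chi s).toLinearMap)

theorem sliceAlg_tmul (s : G) (a : A) (x : GroupCStar G) :
    sliceAlg A s (a ⊗ₜ x) = chi s x • a := rfl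

theorem coeff_sliceAlg (π : CStarRep A) (v w : π.space) (s : G) (z : A ⊗[ℂ] GroupCStar G) :
    π.coeff v w (sliceAlg A s z) = (π.tensor (regularRep G)).coeff
      (vec π (regularRep G) v (vecAt s)) (vec π (regularRep G) w (vecAt 1)) (ofAlg z) := by
  induction z using TensorProduct.induction_on with
  | zero => simp
  | add z z' hz hz' => simp only [map_add, hz, hz']
  | tmul a x =>
    rw [sliceAlg_tmul, map_smul, smul_eq_mul, mul_comm]
    exact (CStarRep.coeff_tensor_tmul π (regularRep G) v w (vecAt s) (vecAt 1) a x).symm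

include δ in
/-- The slice map is contractive: its coefficient at `v, w` is the coefficient of `π ⊗ λ` at
`v ⊗ e_s, w ⊗ e_1`, where `λ` is the regular representation. -/
theorem norm_sliceAlg_le (s : G) (z : A ⊗[ℂ] GroupCStar G) : ‖sliceAlg A s z‖ ≤ 1 * ‖ofAlg z‖ := by
  refine norm_le_of_rep δ fun π => ?_
  rw [one_mul]
  refine ContinuousLinearMap.opNorm_le_bound _ (norm_nonneg _) fun w => ?_
  -- Pair `v` with itself to pass from coefficients to norms.
  set v := π.hom (sliceAlg A s z) w with hv
  have h : ‖v‖ * ‖v‖ ≤ ‖v‖ * (‖ofAlg z‖ * ‖w‖) := by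
    have h1 := (π.tensor (regularRep G)).norm_coeff_le
      (vec π (regularRep G) v (vecAt s)) (vec π (regularRep G) w (vecAt 1)) (ofAlg z)
    rwa [← coeff_sliceAlg, CStarRep.coeff_apply, ← hv, inner_self_eq_norm_sq_to_K,
      CStarRep.norm_vec, CStarRep.norm_vec, norm_vecAt, norm_vecAt, mul_one, mul_one, norm_pow,
      RCLike.norm_ofReal, abs_norm, sq] at h1
  rcases (norm_nonneg v).eq_or_lt with h0 | h0
  · rw [← h0]; positivity
  · exact le_of_mul_le_mul_left h h0

/-- The slice map `id ⊗ χ_s : A ⊗ C*(G) → A`. -/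
def slice (A : Type u) [NonUnitalCStarAlgebra A] (s : G) : SpatialTensor A (GroupCStar G) →L[ℂ] A :=
  (sliceAlg A s).extendOfNorm DoubleCentralizer.ofLin

include δ in
theorem slice_tmul (s : G) (a : A) (x : GroupCStar G) : slice A s (tmul a x) = chi s x • a :=
  LinearMap.extendOfNorm_eq (f := sliceAlg A s) (e := DoubleCentralizer.ofLin)
    SpatialTensor.denseRange_ofAlg ⟨1, norm_sliceAlg_le δ s⟩ (a ⊗ₜ x)

/-- The projection `a ↦ (id ⊗ χ_s)(δ(a))` of `A` to the spectral subspace of `s`. -/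
def component (s : G) : A →L[ℂ] A := (slice A s).comp δ.toHom.toCLM

/-- `δ((id ⊗ χ_s)(z)) = (id ⊗ id ⊗ χ_s)((δ ⊗ id)(z))`, in terms of matrix coefficients. -/
theorem coeff_map_slice (π : CStarRep A) (ρ : CStarRep (GroupCStar G)) (h h' : π.space)
    (k k' : ρ.space) (s : G) (z : SpatialTensor A (GroupCStar G)) :
    (π.tensor ρ).coeff (vec π ρ h k) (vec π ρ h' k') (δ.toHom (slice A s z)) =
      ((π.tensor ρ).tensor (regularRep G)).coeff
        (vec (π.tensor ρ) (regularRep G) (vec π ρ h k) (vecAt s))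
        (vec (π.tensor ρ) (regularRep G) (vec π ρ h' k') (vecAt 1))
        (SpatialTensor.map δ.toHom (NonUnitalStarAlgHom.id ℂ (GroupCStar G)) z) := by
  have key : ((π.tensor ρ).coeff (vec π ρ h k) (vec π ρ h' k')).comp
        (δ.toHom.toCLM.comp (slice A s)) =
      (((π.tensor ρ).tensor (regularRep G)).coeff
        (vec (π.tensor ρ) (regularRep G) (vec π ρ h k) (vecAt s))
        (vec (π.tensor ρ) (regularRep G) (vec π ρ h' k') (vecAt 1))).comp
      (SpatialTensor.map δ.toHom (NonUnitalStarAlgHom.id ℂ (GroupCStar G))).toCLM := by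
    refine clm_ext fun a t => ?_
    simp only [ContinuousLinearMap.comp_apply, NonUnitalStarAlgHom.toCLM_apply]
    rw [slice_tmul δ, map_smul, map_smul, SpatialTensor.map_tmul, CStarRep.coeff_tensor_tmul,
      smul_eq_mul, mul_comm]
    rfl
  exact congrArg (· z) key

include δ in
/-- `(id ⊗ χ_s)(z) ⊗ s = (id ⊗ id ⊗ χ_s)((id ⊗ δ_G)(z))`, in terms of matrix coefficients. It holds
because both sides send `a ⊗ t` to `χ_s(t) (a ⊗ t)`. -/
theorem coeff_tmulOf_slice (π : CStarRep A) (ρ : CStarRep (GroupCStar G)) (h h' : π.space)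
    (k k' : ρ.space) (s : G) (z : SpatialTensor A (GroupCStar G)) :
    (π.tensor ρ).coeff (vec π ρ h k) (vec π ρ h' k') (tmulOf s (slice A s z)) =
      (π.tensor (ρ.tensor (regularRep G))).coeff
        (vec π (ρ.tensor (regularRep G)) h (vec ρ (regularRep G) k (vecAt s)))
        (vec π (ρ.tensor (regularRep G)) h' (vec ρ (regularRep G) k' (vecAt 1)))
        (SpatialTensor.map (NonUnitalStarAlgHom.id ℂ A) (GroupCStar.comul G) z) := by
  classical
  have key : ((π.tensor ρ).coeff (vec π ρ h k) (vec π ρ h' k')).comp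
        ((tmulOf s).comp (slice A s)) =
      ((π.tensor (ρ.tensor (regularRep G))).coeff
        (vec π (ρ.tensor (regularRep G)) h (vec ρ (regularRep G) k (vecAt s)))
        (vec π (ρ.tensor (regularRep G)) h' (vec ρ (regularRep G) k' (vecAt 1)))).comp
      (SpatialTensor.map (NonUnitalStarAlgHom.id ℂ A) (GroupCStar.comul G)).toCLM := by
    refine clm_ext fun a t => ?_
    simp only [ContinuousLinearMap.comp_apply, NonUnitalStarAlgHom.toCLM_apply]
    rw [slice_tmul δ, map_smul, map_smul, SpatialTensor.map_tmul, CStarRep.coeff_tensor_tmul,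
      comul_of, CStarRep.coeff_tensor_tmul, tmulOf_apply, CStarRep.coeff_tensor_tmul,
      smul_eq_mul, NonUnitalStarAlgHom.coe_id, id]
    change _ = _ * (_ * chi s (of t))
    rw [chi_of]
    split_ifs with hst
    · subst hst; ring
    · ring
  exact congrArg (· z) key

/-- By the coaction identity, the two sides of `δ(component s a) = component s a ⊗ s` are slices of
the same element of `A ⊗ C*(G) ⊗ C*(G)`. -/
theorem component_mem (s : G) (a : A) : δ.component s a ∈ δ.spectralSubspace s := by
  rw [mem_spectralSubspace, ← tmulOf_apply]
  refine eq_of_coeff fun π ρ h h' k k' => ?_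
  refine (coeff_map_slice δ π ρ h h' k k' s (δ.toHom a)).trans (Eq.trans ?_
    (coeff_tmulOf_slice δ π ρ h h' k k' s (δ.toHom a)).symm)
  exact δ.coassoc a π ρ (regularRep G) h h' k k' (vecAt s) (vecAt 1)

include δ in
theorem slice_mul_tmul (z : SpatialTensor A (GroupCStar G)) (y : A) (t : G) :
    slice A 1 (z * tmul y (of t)) = slice A t⁻¹ z * y := by
  classical
  have key : (slice A 1).comp ((ContinuousLinearMap.mul ℂ _).flip (tmul y (of t))) =
      ((ContinuousLinearMap.mul ℂ A).flip y).comp (slice A t⁻¹) := by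
    refine clm_ext fun a r => ?_
    simp only [ContinuousLinearMap.comp_apply, ContinuousLinearMap.flip_apply,
      ContinuousLinearMap.mul_apply']
    rw [tmul_mul_tmul, of_mul_of, slice_tmul δ, slice_tmul δ, chi_of, chi_of, smul_mul_assoc]
    congr 2
    exact propext ⟨fun h => by rw [inv_eq_of_mul_eq_one_left h.symm], fun h => by rw [← h]; simp⟩
  exact congrArg (· z) key

/-- The products `b y` of spectral elements `b` and arbitrary elements `y` of `A`. -/
def spectralMul : Set A := {z | ∃ s, ∃ b ∈ δ.spectralSubspace s, ∃ y, z = b * y}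

/-- The spectral elements generate `A` as a closed right ideal: slicing an approximation
`x ⊗ 1 ≈ ∑ δ(a) (y ⊗ t)` by `χ_1` gives `x ≈ ∑ component t⁻¹ a * y`. -/
theorem spectralMul_dense : (Submodule.span ℂ δ.spectralMul).topologicalClosure = ⊤ := by
  classical
  set W := (Submodule.span ℂ δ.spectralMul).topologicalClosure with hW
  have hWc : IsClosed (W : Set A) := Submodule.isClosed_topologicalClosure _
  let K : Submodule ℂ (SpatialTensor A (GroupCStar G)) := W.comap (slice A 1).toLinearMap
  have hKc : IsClosed (K : Set (SpatialTensor A (GroupCStar G))) :=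
    hWc.preimage (slice A 1).continuous
  have h1 : ∀ a z, δ.toHom a * z ∈ K := fun a z => by
    have h2 := eq_top_of_tmul_of_mem
      (K := K.comap (ContinuousLinearMap.mul ℂ _ (δ.toHom a)).toLinearMap)
      (hKc.preimage (ContinuousLinearMap.mul ℂ _ (δ.toHom a)).continuous) fun y t => by
        change slice A 1 (δ.toHom a * tmul y (of t)) ∈ W
        rw [slice_mul_tmul δ]
        exact Submodule.le_topologicalClosure _
          (Submodule.subset_span ⟨t⁻¹, _, δ.component_mem t⁻¹ a, y, rfl⟩)
    exact Submodule.eq_top_iff'.1 h2 z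
  have h3 : K = ⊤ := top_le_iff.1 <| δ.nondegenerate.symm.le.trans <|
    Submodule.topologicalClosure_minimal _ (Submodule.span_le.2 (by
      rintro _ ⟨a, z, rfl⟩; exact h1 a z)) hKc
  refine Submodule.eq_top_iff'.2 fun x => ?_
  have h4 : slice A 1 (tmul x (of (1 : G))) ∈ W := Submodule.eq_top_iff'.1 h3 _
  rwa [slice_tmul δ, chi_of, if_pos rfl, one_smul] at h4

end Coaction

namespace Coaction

variable {G A : Type u} [Group G] [NonUnitalCStarAlgebra A] (δ : Coaction G A)

/-! ### Multipliers of the associated Fell bundle -/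

section Value

variable {δ}

/-- An element of the associated Fell bundle, as an element of `A`. -/
def val (a : δ.fellBundle.Total) : A :=
  let b : δ.spectralSubspace a.1 := a.2
  b

/-- An element of a spectral subspace, as an element of the associated Fell bundle. -/
def toTotal {s : G} {a : A} (ha : a ∈ δ.spectralSubspace s) : δ.fellBundle.Total := ⟨s, ⟨a, ha⟩⟩

theorem val_mem (a : δ.fellBundle.Total) : val a ∈ δ.spectralSubspace a.1 :=
  let b : δ.spectralSubspace a.1 := a.2
  b.2

theorem val_mul (a b : δ.fellBundle.Total) : val (a * b) = val a * val b := rfl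

theorem val_star (a : δ.fellBundle.Total) : val (star a) = star (val a) := rfl

theorem val_toTotal {s : G} {a : A} (ha : a ∈ δ.spectralSubspace s) : val (toTotal ha) = a := rfl

theorem total_ext {a b : δ.fellBundle.Total} (hf : a.1 = b.1) (h : val a = val b) : a = b :=
  δ.sigma_ext hf h

end Value

section Extension

/-- Continuous linear maps on `A` that agree on the products `b y` with `b` spectral are equal. -/
theorem clm_ext {E : Type v} [NormedAddCommGroup E] [NormedSpace ℂ E] {f g : A →L[ℂ] E}
    (h : ∀ (b : δ.fellBundle.Total) (y : A), f (val b * y) = g (val b * y)) : f = g := by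
  have h1 : LinearMap.eqLocus f.toLinearMap g.toLinearMap = ⊤ :=
    top_le_iff.1 <| δ.spectralMul_dense.symm.le.trans <|
      Submodule.topologicalClosure_minimal _ (Submodule.span_le.2 (by
        rintro _ ⟨s, b, hb, y, rfl⟩
        exact h (toTotal hb) y)) (isClosed_eq f.continuous g.continuous)
  exact ContinuousLinearMap.ext fun z => Submodule.eq_top_iff'.1 h1 z

/-- The linear map `(b, y) ↦ b y` on the free vector space on pairs of a spectral element `b` and
an element `y` of `A`. -/
def mulPairs : (δ.fellBundle.Total × A →₀ ℂ) →ₗ[ℂ] A :=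
  Finsupp.linearCombination ℂ fun p => val p.1 * p.2

/-- The linear map `(b, y) ↦ (m b) y` on the free vector space on pairs of a spectral element `b`
and an element `y` of `A`. -/
def mulPairsLeft (m : δ.fellBundle.Multiplier) : (δ.fellBundle.Total × A →₀ ℂ) →ₗ[ℂ] A :=
  Finsupp.linearCombination ℂ fun p => val (m.left p.1) * p.2

theorem denseRange_mulPairs : DenseRange δ.mulPairs := by
  have h : (LinearMap.range δ.mulPairs).topologicalClosure = ⊤ := by
    refine top_le_iff.1 (δ.spectralMul_dense.symm.le.trans (Submodule.topologicalClosure_mono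
      (Submodule.span_le.2 ?_)))
    rintro _ ⟨s, b, hb, y, rfl⟩
    refine ⟨Finsupp.single (toTotal hb, y) 1, ?_⟩
    rw [mulPairs, Finsupp.linearCombination_single, one_smul, val_toTotal]
  exact (Submodule.dense_iff_topologicalClosure_eq_top).2 h

theorem star_linearCombination_mul {ι : Type*} {f g f' g' : ι → A}
    (h : ∀ i j, star (f i) * g j = star (f' i) * g' j) (v w : ι →₀ ℂ) :
    star (Finsupp.linearCombination ℂ f v) * Finsupp.linearCombination ℂ g w =
      star (Finsupp.linearCombination ℂ f' v) * Finsupp.linearCombination ℂ g' w := by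
  induction v using Finsupp.induction_linear with
  | zero => simp
  | add v v' hv hv' => simp only [map_add, star_add, add_mul, hv, hv']
  | single i c =>
    induction w using Finsupp.induction_linear with
    | zero => simp
    | add w w' hw hw' => simp only [map_add, mul_add, hw, hw']
    | single j d =>
      simp only [Finsupp.linearCombination_single, star_smul, smul_mul_assoc, mul_smul_comm, h]

theorem star_mulPairsLeft_mul (m : unitary δ.fellBundle.Multiplier)
    (v w : δ.fellBundle.Total × A →₀ ℂ) :
    star (δ.mulPairsLeft m v) * δ.mulPairsLeft m w = star (δ.mulPairs v) * δ.mulPairs w :=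
  star_linearCombination_mul (fun p q => by
    have h := congrArg val (PullbackBundle.Multiplier.star_unitary_left_mul m p.1 q.1)
    rw [val_mul, val_mul, val_star, val_star] at h
    rw [star_mul, star_mul, mul_assoc, ← mul_assoc _ _ q.2, h, mul_assoc, mul_assoc]) v w

theorem star_mulPairsLeft_star_mul (m : δ.fellBundle.Multiplier)
    (v w : δ.fellBundle.Total × A →₀ ℂ) :
    star (δ.mulPairsLeft (star m) v) * δ.mulPairs w = star (δ.mulPairs v) * δ.mulPairsLeft m w :=
  star_linearCombination_mul (fun p q => by
    have h := congrArg val (m.assoc (star p.1) q.1)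
    rw [← star_star (m.right _), ← PullbackBundle.Multiplier.star_left, val_mul, val_mul, val_star,
      val_star] at h
    rw [star_mul, star_mul, mul_assoc, ← mul_assoc _ _ q.2, h, mul_assoc, mul_assoc]) v w

theorem norm_mulPairsLeft (m : unitary δ.fellBundle.Multiplier)
    (v : δ.fellBundle.Total × A →₀ ℂ) : ‖δ.mulPairsLeft m v‖ = ‖δ.mulPairs v‖ := by
  rw [← mul_self_inj_of_nonneg (norm_nonneg _) (norm_nonneg _), ← CStarRing.norm_star_mul_self,
    star_mulPairsLeft_mul, CStarRing.norm_star_mul_self]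

/-- Left multiplication `b y ↦ (m b) y` by a unitary multiplier `m` of the associated Fell
bundle. -/
def leftExtension (m : unitary δ.fellBundle.Multiplier) : A →L[ℂ] A :=
  (δ.mulPairsLeft m).extendOfNorm δ.mulPairs

theorem leftExtension_mulPairs (m : unitary δ.fellBundle.Multiplier)
    (v : δ.fellBundle.Total × A →₀ ℂ) :
    δ.leftExtension m (δ.mulPairs v) = δ.mulPairsLeft m v :=
  LinearMap.extendOfNorm_eq δ.denseRange_mulPairs
    ⟨1, fun v => by rw [one_mul]; exact (δ.norm_mulPairsLeft m v).le⟩ v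

theorem leftExtension_mul (m : unitary δ.fellBundle.Multiplier) (b : δ.fellBundle.Total) (y : A) :
    δ.leftExtension m (val b * y) = val ((m : δ.fellBundle.Multiplier).left b) * y := by
  have h := δ.leftExtension_mulPairs m (Finsupp.single (b, y) 1)
  rwa [mulPairs, mulPairsLeft, Finsupp.linearCombination_single, Finsupp.linearCombination_single,
    one_smul, one_smul] at h

theorem star_leftExtension_star_mul (m : unitary δ.fellBundle.Multiplier) (x y : A) :
    star (δ.leftExtension (star m) x) * y = star x * δ.leftExtension m y := by
  refine δ.denseRange_mulPairs.induction_on₂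
    (p := fun x y => star (δ.leftExtension (star m) x) * y = star x * δ.leftExtension m y)
    (isClosed_eq (by fun_prop) (by fun_prop)) (fun v w => ?_) x y
  rw [leftExtension_mulPairs, leftExtension_mulPairs]
  exact δ.star_mulPairsLeft_star_mul m v w

/-- The extension to `A` of a unitary multiplier of the associated Fell bundle. -/
def extendMultiplier (m : unitary δ.fellBundle.Multiplier) : 𝓜(ℂ, A) where
  fst := δ.leftExtension m
  snd := ((starL ℂ : A ≃L⋆[ℂ] A) : A →L⋆[ℂ] A).comp
    ((δ.leftExtension (star m)).comp ((starL ℂ : A ≃L⋆[ℂ] A) : A →L⋆[ℂ] A))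
  central x y := by
    change star (δ.leftExtension (star m) (star x)) * y = x * δ.leftExtension m y
    rw [star_leftExtension_star_mul, star_star]

theorem extendMultiplier_fst_mul (m : unitary δ.fellBundle.Multiplier) (b : δ.fellBundle.Total)
    (y : A) : (δ.extendMultiplier m).fst (val b * y) =
      val ((m : δ.fellBundle.Multiplier).left b) * y := δ.leftExtension_mul m b y

theorem multiplier_ext {m m' : 𝓜(ℂ, A)}
    (h : ∀ (b : δ.fellBundle.Total) (y : A), m.fst (val b * y) = m'.fst (val b * y)) : m = m' :=
  DoubleCentralizer.ext_fst fun x => congrArg (· x) (δ.clm_ext h)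

theorem star_extendMultiplier (m : unitary δ.fellBundle.Multiplier) :
    star (δ.extendMultiplier m) = δ.extendMultiplier (star m) :=
  DoubleCentralizer.ext_fst fun x => by
    rw [DoubleCentralizer.star_fst]
    change star (star (δ.leftExtension (star m) (star (star x)))) = δ.leftExtension (star m) x
    rw [star_star, star_star]

/-- The extension to `A` of unitary multipliers of the associated Fell bundle, as a
homomorphism. -/
def extendUnitary : unitary δ.fellBundle.Multiplier →* unitary 𝓜(ℂ, A) :=
  MonoidHom.toUnitary
    { toFun := δ.extendMultiplier
      map_one' := δ.multiplier_ext fun b y => δ.extendMultiplier_fst_mul 1 b y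
      map_mul' := fun m m' => δ.multiplier_ext fun b y => by
        rw [DoubleCentralizer.mul_fst, mul_apply_eq_comp]
        simp only [extendMultiplier_fst_mul]
        rfl }
    δ.star_extendMultiplier

theorem extendUnitary_fst_mul (m : unitary δ.fellBundle.Multiplier) (b : δ.fellBundle.Total)
    (y : A) : (δ.extendUnitary m : 𝓜(ℂ, A)).fst (val b * y) =
      val ((m : δ.fellBundle.Multiplier).left b) * y := δ.leftExtension_mul m b y

theorem extendUnitary_fst (m : unitary δ.fellBundle.Multiplier) (b : δ.fellBundle.Total) :
    (δ.extendUnitary m : 𝓜(ℂ, A)).fst (val b) = val ((m : δ.fellBundle.Multiplier).left b) :=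
  DoubleCentralizer.eq_of_mul_left fun y => by
    rw [← DoubleCentralizer.fst_mul, extendUnitary_fst_mul]

theorem extendUnitary_snd (m : unitary δ.fellBundle.Multiplier) (b : δ.fellBundle.Total) :
    (δ.extendUnitary m : 𝓜(ℂ, A)).snd (val b) = val ((m : δ.fellBundle.Multiplier).right b) := by
  have key : ContinuousLinearMap.mul ℂ A ((δ.extendUnitary m : 𝓜(ℂ, A)).snd (val b)) =
      ContinuousLinearMap.mul ℂ A (val ((m : δ.fellBundle.Multiplier).right b)) :=
    δ.clm_ext fun c y => by
      rw [ContinuousLinearMap.mul_apply', ContinuousLinearMap.mul_apply',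
        DoubleCentralizer.central, extendUnitary_fst_mul, ← mul_assoc, ← mul_assoc, ← val_mul,
        ← val_mul, FellBundle.Multiplier.assoc]
  exact DoubleCentralizer.eq_of_mul_left fun y => congrArg (· y) key

theorem tensor_fst_of_mem (m : unitary 𝓜(ℂ, A)) (t : G) {s : G} {a : A}
    (ha : a ∈ δ.spectralSubspace s) :
    (DoubleCentralizer.tensor m (GroupCStar.unitaryOf t)).fst (δ.toHom a) =
      SpatialTensor.tmul ((m : 𝓜(ℂ, A)).fst a) (GroupCStar.of (t * s)) := by
  rw [δ.mem_spectralSubspace.1 ha, DoubleCentralizer.tensor_fst_tmul, ← GroupCStar.of_mul_of]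
  rfl

theorem extend_extendUnitary (m : unitary δ.fellBundle.Multiplier) (t : G)
    (hm : (m : δ.fellBundle.Multiplier) ∈ δ.fellBundle.multipliersOfOrder t) :
    δ.extend (δ.extendUnitary m) =
      DoubleCentralizer.tensor (δ.extendUnitary m) (GroupCStar.unitaryOf t) := by
  refine (DoubleCentralizer.eq_extend δ.nondegenerate _ _ fun a => ?_).symm
  have key : (DoubleCentralizer.tensor (δ.extendUnitary m) (GroupCStar.unitaryOf t)).fst.comp
      δ.toHom.toCLM = δ.toHom.toCLM.comp (δ.extendUnitary m : 𝓜(ℂ, A)).fst := by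
    refine δ.clm_ext fun b y => ?_
    simp only [ContinuousLinearMap.comp_apply, NonUnitalStarAlgHom.toCLM_apply]
    rw [map_mul, DoubleCentralizer.fst_mul, tensor_fst_of_mem δ _ t (val_mem b),
      DoubleCentralizer.fst_mul, map_mul, extendUnitary_fst,
      δ.mem_spectralSubspace.1 (val_mem _), hm.1]
  exact congrArg (· a) key

end Extension

section Restriction

variable {N : Subgroup G} [N.Normal]

/-- The condition on `u : N → UM(A)` that characterizes weakly induced coactions:
`δ(u_n) = u_n ⊗ n`, and `a u_n = u_{s n s⁻¹} a` for `a` in the spectral subspace of `s`. -/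
structure IsCommuting (u : N →* unitary 𝓜(ℂ, A)) : Prop where
  extend_eq : ∀ n : N,
    δ.extend (u n) = DoubleCentralizer.tensor (u n) (GroupCStar.unitaryOf (n : G))
  comm : ∀ (s : G), ∀ a ∈ δ.spectralSubspace s, ∀ n : N,
    (u n : 𝓜(ℂ, A)).snd a =
      (u ⟨s * n * s⁻¹, Subgroup.Normal.conj_mem inferInstance n.1 n.2 s⟩ : 𝓜(ℂ, A)).fst a

variable {δ} {u : N →* unitary 𝓜(ℂ, A)}

namespace IsCommuting

variable (hu : δ.IsCommuting u)

include hu in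
theorem fst_mem (n : N) {s : G} {a : A} (ha : a ∈ δ.spectralSubspace s) :
    (u n : 𝓜(ℂ, A)).fst a ∈ δ.spectralSubspace (n * s) := by
  rw [mem_spectralSubspace, ← tensor_fst_of_mem δ (u n) n ha, ← hu.extend_eq]
  exact (DoubleCentralizer.extend_fst_map δ.nondegenerate _ a).symm

include hu in
theorem snd_mem (n : N) {s : G} {a : A} (ha : a ∈ δ.spectralSubspace s) :
    (u n : 𝓜(ℂ, A)).snd a ∈ δ.spectralSubspace (s * n) := by
  have h := hu.fst_mem ⟨s * n * s⁻¹, Subgroup.Normal.conj_mem inferInstance n.1 n.2 s⟩ ha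
  rwa [← hu.comm s a ha, inv_mul_cancel_right] at h

/-- The multiplier of the associated Fell bundle given by `u n`. -/
def restrict (n : N) : δ.fellBundle.Multiplier where
  left a := toTotal (hu.fst_mem n (val_mem a))
  right a := toTotal (hu.snd_mem n (val_mem a))
  exists_order := ⟨n, fun _ => rfl, fun _ => rfl⟩
  assoc a b := total_ext (mul_assoc _ _ _) ((u n : 𝓜(ℂ, A)).central (val a) (val b))

/-- The unitary multipliers of the associated Fell bundle given by `u`. -/
def restrictUnitary : N →* unitary δ.fellBundle.Multiplier :=
  MonoidHom.toUnitary
    { toFun := hu.restrict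
      map_one' := by
        ext1 <;> funext a
        · refine total_ext (one_mul _) ?_
          change (u 1 : 𝓜(ℂ, A)).fst (val a) = val a
          rw [map_one]; rfl
        · refine total_ext (mul_one _) ?_
          change (u 1 : 𝓜(ℂ, A)).snd (val a) = val a
          rw [map_one]; rfl
      map_mul' := fun m n => by
        ext1 <;> funext a
        · refine total_ext (mul_assoc _ _ _) ?_
          change (u (m * n) : 𝓜(ℂ, A)).fst (val a) =
            (u m : 𝓜(ℂ, A)).fst ((u n : 𝓜(ℂ, A)).fst (val a))
          rw [map_mul]; rfl
        · refine total_ext (mul_assoc _ _ _).symm ?_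
          change (u (m * n) : 𝓜(ℂ, A)).snd (val a) =
            (u n : 𝓜(ℂ, A)).snd ((u m : 𝓜(ℂ, A)).snd (val a))
          rw [map_mul]; rfl }
    fun n => by
      ext1 <;> funext a
      · refine total_ext (show (a.1⁻¹ * (n : G))⁻¹ = (n : G)⁻¹ * a.1 by group) ?_
        change star ((u n : 𝓜(ℂ, A)).snd (star (val a))) = (u n⁻¹ : 𝓜(ℂ, A)).fst (val a)
        rw [unitary.coe_map_inv, DoubleCentralizer.star_fst]
      · refine total_ext (show ((n : G) * a.1⁻¹)⁻¹ = a.1 * (n : G)⁻¹ by group) ?_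
        change star ((u n : 𝓜(ℂ, A)).fst (star (val a))) = (u n⁻¹ : 𝓜(ℂ, A)).snd (val a)
        rw [unitary.coe_map_inv, DoubleCentralizer.star_snd]

theorem isCommuting_restrictUnitary : PullbackBundle.IsCommuting hu.restrictUnitary where
  order _ := ⟨fun _ => rfl, fun _ => rfl⟩
  comm a n := total_ext (inv_mul_cancel_right _ _).symm (hu.comm a.1 (val a) (val_mem a) n)

end IsCommuting

theorem isCommuting_extendUnitary {w : N →* unitary δ.fellBundle.Multiplier}
    (hw : PullbackBundle.IsCommuting w) : δ.IsCommuting (δ.extendUnitary.comp w) where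
  extend_eq n := δ.extend_extendUnitary (w n) n (hw.order n)
  comm s a ha n := by
    have h := congrArg val (hw.comm (toTotal ha) n)
    rw [← extendUnitary_snd, ← extendUnitary_fst] at h
    exact h

variable (δ) in
/-- A coaction is weakly induced if and only if it has a commuting homomorphism to the unitary
multipliers of `A`. -/
theorem isWeaklyInduced_iff (N : Subgroup G) [N.Normal] :
    δ.IsWeaklyInduced N ↔ ∃ u : N →* unitary 𝓜(ℂ, A), δ.IsCommuting u :=
  (PullbackBundle.exists_iso_pullback_iff δ.fellBundle N).trans
    ⟨fun ⟨_, hw⟩ => ⟨_, isCommuting_extendUnitary hw⟩,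
      fun ⟨_, hu⟩ => ⟨_, hu.isCommuting_restrictUnitary⟩⟩

end Restriction

end Coaction

end

theorem theorem5p1 {G : Type u} [Group G] (N : Subgroup G) [N.Normal] :
    (∀ 𝒜 : FellBundle.{u, v} G,
      (∃ 𝒟 : FellBundle.{u, v} (G ⧸ N), Nonempty (𝒜.Iso (FellBundle.pullback N 𝒟))) ↔
        ∃ u : N →* unitary 𝒜.Multiplier,
          (∀ n : N, (u n : 𝒜.Multiplier) ∈ 𝒜.multipliersOfOrder (n : G)) ∧
          ∀ (a : 𝒜.Total) (n : N),
            (u n : 𝒜.Multiplier).right a =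
              (u ⟨a.1 * n * a.1⁻¹, Subgroup.Normal.conj_mem inferInstance n.1 n.2 a.1⟩ :
                𝒜.Multiplier).left a) ∧
    (∀ (A : Type u) [NonUnitalCStarAlgebra A] (δ : Coaction G A),
      δ.IsWeaklyInduced N ↔
        ∃ u : N →* unitary 𝓜(ℂ, A),
          (∀ n : N, δ.extend (u n) = DoubleCentralizer.tensor (u n) (GroupCStar.unitaryOf (n : G))) ∧
          ∀ (s : G), ∀ a ∈ δ.spectralSubspace s, ∀ n : N,
            (u n : 𝓜(ℂ, A)).snd a =
              (u ⟨s * n * s⁻¹, Subgroup.Normal.conj_mem inferInstance n.1 n.2 s⟩ :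
                𝓜(ℂ, A)).fst a) := by
  refine ⟨fun 𝒜 => ?_, fun A _ δ => ?_⟩
  · exact (PullbackBundle.exists_iso_pullback_iff 𝒜 N).trans
      ⟨fun ⟨u, hu⟩ => ⟨u, hu.order, hu.comm⟩, fun ⟨u, h, h'⟩ => ⟨u, h, h'⟩⟩
  · exact (δ.isWeaklyInduced_iff N).trans
      ⟨fun ⟨u, hu⟩ => ⟨u, hu.extend_eq, hu.comm⟩, fun ⟨u, h, h'⟩ => ⟨u, h, h'⟩⟩
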